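/- Let $E$ be a Polish space, $\Theta$ a real Banach space with dual $\Theta^*$, and $(K_\theta)_{\theta\in\Theta}$ a family of Markov transition kernels on $E$. Let $h:E\to\mathbb R^p$ be bounded and continuous, let $\sigma>0$, and let $g$ be the density of the Gaussian distribution $N(0,\sigma^2 I_p)$. For a probability measure $\mu$ on $E$, let $P_{\mu,\theta}$ be the law of the Markov chain $(X_n)_{n\ge0}$ with initial distribution $\mu$ and kernel $K_\theta$, and let $\mathbb P_{\mu,\theta}$ (with expectation $\mathbb E_{\mu,\theta}$) be the joint law of $X$ and $Y_n=h(X_n)+V_n$, where the $V_n$ are i.i.d. $N(0,\sigma^2I_p)$ and independent of $X$. The optimal filter $\Psi^\theta_n(\mu)$ is the random probability measure on $E$ given by $$\Psi^\theta_n(\mu)(f)=\frac{\int f(x_n)\prod_{k=1}^n g(Y_k-h(x_k))\,P_{\mu,\theta}(dx)}{\int \prod_{k=1}^n g(Y_k-h(x_k))\,P_{\mu,\theta}(dx)} .$$ Let $\alpha\in\Theta$ and assume the following. 1. $K_\alpha$ is mixing: there are $0<\epsilon\le1$ and a finite nonnegative measure $\lambda$ on $E$ with $\epsilon\lambda(A)\le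 K_\alpha(x,A)\le\epsilon^{-1}\lambda(A)$ for all $x\in E$ and all Borel sets $A$. 2. The limiting distribution $\nu_\alpha=(\mu_\alpha\circ h^{-1})*g$ of the observations has finite first two moments, where $\mu_\alpha$ is the limiting distribution of the Markov chain with kernel $K_\alpha$. 3. There is a neighbourhood $\mathcal N(\alpha)$ of $\alpha$ such that for every $\theta\in\mathcal N(\alpha)$ the kernel has a Fréchet derivative $L_\theta:C_b(E)\to C_b(E,\Theta^*)$ in the weak operator sense: for all probability measures $m$ on $E$ and all $f\in C_b(E)$, the function $\eta\mapsto m(K_\eta f)$ is Fréchet differentiable at $\theta$ with derivative $m(L_\theta f)\in\Theta^*$. Moreover, for every $\theta\in\mathcal N(\alpha)$, the function $$\Lambda_\theta(x)=\sup_{x'\in E}\Big\|\frac{dL_\theta(x',\cdot)}{dK_\theta(x',\cdot)}(x)\Big\|_{\Theta^*}\in[0,\infty]$$ is well defined. That is, there are densities $\ell_\theta(x',x)\in\Theta^*$ such that for all $x'\in E$ and $v\in\Theta$ the function $\ell_\theta(x',\cdot)v$ is $K_\theta(x',\cdot)$-integrable and $L_\theta f(x')v=\int f(x)\,\ell_\theta(x',x)v\,K_\theta(x',dx)$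 for all $f\in C_b(E)$, and $\Lambda_\theta(x)=\sup_{x'}\|\ell_\theta(x',x)\|$ is a universally measurable function of $x$. 4. For a given probability measure $\mu$ on $E$, $$\sup_{n>0}\ \sup_{\theta,\theta'\in\mathcal N(\alpha)}\Big(\mathbb E_{\mu,\theta}\big[(K_{\theta'}\Lambda_{\theta'}^{\,n+1})(X_{n-1})\big]\Big)^{\frac1{n+1}}<+\infty .$$ Then the optimal filters are almost surely uniformly continuous with respect to the parameter at $\alpha$, in the sense that, for every probability measure $\mu'$ on $E$, $$\lim_{\theta\to\alpha}\ \sup_{n>0}\ \mathbb E_{\mu',\alpha}\big\|\Psi^\theta_n(\mu)-\Psi^\alpha_n(\mu)\big\|_{tv}=0 .$$ -/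

import Mathlib

open MeasureTheory ProbabilityTheory Filter Topology
open scoped ENNReal BoundedContinuousFunction

namespace HMMFilter

noncomputable section

/-- The mixing condition: `ε lam(A) ≤ κ(x, A) ≤ ε⁻¹ lam(A)` for all points `x` and Borel sets `A`,
for some constant `0 < ε ≤ 1` and some finite nonnegative measure `lam`. -/
def IsMixing {E : Type*} [MeasurableSpace E] (κ : Kernel E E) : Prop :=
  ∃ ε : ℝ, 0 < ε ∧ ε ≤ 1 ∧ ∃ lam : Measure E, IsFiniteMeasure lam ∧
    ∀ (x : E) (A : Set E), MeasurableSet A →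
      ENNReal.ofReal ε * lam A ≤ κ x A ∧ κ x A ≤ ENNReal.ofReal (1 / ε) * lam A

/-- The law on path space `ℕ → E` of the homogeneous Markov chain `X 0, X 1, …` with initial
distribution `μ` and transition kernel `κ` (given by the Ionescu-Tulcea theorem). -/
def chainLaw {E : Type*} [MeasurableSpace E] (μ : Measure E) (κ : Kernel E E) [IsMarkovKernel κ] :
    Measure (ℕ → E) :=
  Kernel.trajMeasure (X := fun _ => E) μ fun n =>
    κ.comap (fun x : (i : Finset.Iic n) → E => x ⟨n, Finset.mem_Iic.2 le_rfl⟩)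
      (measurable_pi_apply _)

instance {E : Type*} [MeasurableSpace E] (μ : Measure E) [IsProbabilityMeasure μ]
    (κ : Kernel E E) [IsMarkovKernel κ] : IsProbabilityMeasure (chainLaw μ κ) := by
  unfold chainLaw; infer_instance

/-- The density `g` of the centred Gaussian distribution on `ℝ^p` with covariance `σ² I`. -/
def gaussDensity {p : ℕ} (σ : ℝ) (v : EuclideanSpace ℝ (Fin p)) : ℝ :=
  (2 * Real.pi * σ ^ 2) ^ (-(p : ℝ) / 2) * Real.exp (-‖v‖ ^ 2 / (2 * σ ^ 2))

/-- The law of the observational noise: the centred Gaussian distribution with covariance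
`σ² I`. -/
def gaussNoise (p : ℕ) (σ : ℝ) : Measure (EuclideanSpace ℝ (Fin p)) :=
  volume.withDensity fun v => ENNReal.ofReal (gaussDensity σ v)

theorem isProbabilityMeasure_gaussNoise (p : ℕ) {σ : ℝ} (hσ : 0 < σ) :
    IsProbabilityMeasure (gaussNoise p σ) := by
  have hb : 0 < 1 / (2 * σ ^ 2) := by positivity
  have h0 : 0 < 2 * Real.pi * σ ^ 2 := by positivity
  have hI := GaussianFourier.integral_rexp_neg_mul_sq_norm
    (V := EuclideanSpace ℝ (Fin p)) hb
  have hg : ∀ v : EuclideanSpace ℝ (Fin p), gaussDensity σ v =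
      (2 * Real.pi * σ ^ 2) ^ (-(p : ℝ) / 2) * Real.exp (-(1 / (2 * σ ^ 2)) * ‖v‖ ^ 2) := by
    intro v
    unfold gaussDensity
    congr 2
    ring
  have hval : ∫ v : EuclideanSpace ℝ (Fin p), gaussDensity σ v = 1 := by
    simp_rw [hg]
    rw [integral_const_mul, hI, finrank_euclideanSpace_fin]
    have : Real.pi / (1 / (2 * σ ^ 2)) = 2 * Real.pi * σ ^ 2 := by field_simp
    rw [this, ← Real.rpow_add h0]
    have : -(p : ℝ) / 2 + (p : ℝ) / 2 = 0 := by ring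
    rw [this, Real.rpow_zero]
  refine ⟨?_⟩
  rw [gaussNoise, withDensity_apply _ MeasurableSet.univ, Measure.restrict_univ,
    ← ofReal_integral_eq_lintegral_ofReal, hval, ENNReal.ofReal_one]
  · by_contra hc
    rw [integral_undef hc] at hval
    exact zero_ne_one hval
  · refine ae_of_all _ fun v => ?_
    unfold gaussDensity
    positivity

/-- The joint law of the signal `X` and of the observations `Y n = h (X n) + V n`, where `X` is the
Markov chain with initial distribution `μ` and kernel `κ`, and the `V n` are i.i.d. centred
Gaussian with covariance `σ² I`, independent of `X`. (Only `Y 1, Y 2, …` are ever used.) -/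
def pairLaw {E : Type*} [MeasurableSpace E] {p : ℕ} (h : E → EuclideanSpace ℝ (Fin p))
    {σ : ℝ} (hσ : 0 < σ) (μ : Measure E) (κ : Kernel E E) [IsMarkovKernel κ] :
    Measure ((ℕ → E) × (ℕ → EuclideanSpace ℝ (Fin p))) :=
  haveI := isProbabilityMeasure_gaussNoise p hσ
  ((chainLaw μ κ).prod (Measure.infinitePi fun _ : ℕ => gaussNoise p σ)).map
    fun ω => (ω.1, fun n => h (ω.1 n) + ω.2 n)

/-- The unnormalised optimal filter at time `n` along the observations `y`:
`f ↦ ∫ f(x n) ∏_{k=1}^n g(y k - h(x k)) P_{μ,κ}(dx)`. -/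
def unnormalizedFilter {E : Type*} [MeasurableSpace E] {p : ℕ}
    (h : E → EuclideanSpace ℝ (Fin p)) (σ : ℝ) (μ : Measure E) (κ : Kernel E E)
    [IsMarkovKernel κ] (n : ℕ) (y : ℕ → EuclideanSpace ℝ (Fin p)) : Measure E :=
  ((chainLaw μ κ).withDensity fun x =>
    ENNReal.ofReal (∏ k ∈ Finset.Icc 1 n, gaussDensity σ (y k - h (x k)))).map fun x => x n

/-- The optimal filter `Ψ_n(μ)`: the posterior distribution of `X n` given the observations
`y 1, …, y n`, for the model with initial distribution `μ` and kernel `κ`. -/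
def optimalFilter {E : Type*} [MeasurableSpace E] {p : ℕ}
    (h : E → EuclideanSpace ℝ (Fin p)) (σ : ℝ) (μ : Measure E) (κ : Kernel E E)
    [IsMarkovKernel κ] (n : ℕ) (y : ℕ → EuclideanSpace ℝ (Fin p)) : Measure E :=
  (unnormalizedFilter h σ μ κ n y Set.univ)⁻¹ • unnormalizedFilter h σ μ κ n y

instance {E : Type*} [MeasurableSpace E] {p : ℕ}
    (h : E → EuclideanSpace ℝ (Fin p)) (σ : ℝ) (μ : Measure E) (κ : Kernel E E)
    [IsMarkovKernel κ] (n : ℕ) (y : ℕ → EuclideanSpace ℝ (Fin p)) :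
    IsFiniteMeasure (optimalFilter h σ μ κ n y) := by
  refine ⟨?_⟩
  rw [optimalFilter, Measure.smul_apply, smul_eq_mul]
  exact (ENNReal.inv_mul_le_one _).trans_lt ENNReal.one_lt_top

/-- The total variation norm `‖μ - ν‖_tv`. -/
def tvDist {E : Type*} [MeasurableSpace E] (μ ν : Measure E) [IsFiniteMeasure μ]
    [IsFiniteMeasure ν] : ℝ≥0∞ :=
  (μ.toSignedMeasure - ν.toSignedMeasure).totalVariation Set.univ

/-- `ρ` is the limiting distribution of the Markov chain with kernel `κ`: whatever the initial
distribution, the law of `X n` converges weakly to `ρ`. -/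
def IsLimitingDistribution {E : Type*} [TopologicalSpace E] [MeasurableSpace E]
    (κ : Kernel E E) [IsMarkovKernel κ] (ρ : Measure E) : Prop :=
  IsProbabilityMeasure ρ ∧ ∀ (μ : Measure E) [IsProbabilityMeasure μ] (f : E →ᵇ ℝ),
    Tendsto (fun n : ℕ => ∫ x, f (x n) ∂chainLaw μ κ) atTop (𝓝 (∫ x, f x ∂ρ))

/-- The limiting distribution `ν = (ρ ∘ h⁻¹) ∗ g` of the observations, for the limiting
distribution `ρ` of the signal. -/
def observationLimit {E : Type*} [MeasurableSpace E] {p : ℕ}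
    (h : E → EuclideanSpace ℝ (Fin p)) (σ : ℝ) (ρ : Measure E) :
    Measure (EuclideanSpace ℝ (Fin p)) :=
  (ρ.map h).conv (gaussNoise p σ)

/-- `L : C_b(E) → C_b(E, Θ*)` is the Fréchet derivative at `θ` of the family of kernels `K`, in the
weak operator sense: for every probability measure `μ` and every `f ∈ C_b(E)`, the real function
`η ↦ μ(K_η f)` is Fréchet differentiable at `θ` with derivative `μ(L f) ∈ Θ*`. For `Θ = ℝ`, the
dual `Θ*` is `ℝ` and `L` maps `C_b(E)` to itself. -/
def IsWeakFDerivAt {E Θ : Type*} [TopologicalSpace E] [MeasurableSpace E]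
    [NormedAddCommGroup Θ] [NormedSpace ℝ Θ] (K : Θ → Kernel E E)
    (L : (E →ᵇ ℝ) → (E →ᵇ StrongDual ℝ Θ)) (θ : Θ) : Prop :=
  ∀ (μ : Measure E) [IsProbabilityMeasure μ] (f : E →ᵇ ℝ),
    HasFDerivAt (fun η => ∫ x', ∫ x, f x ∂K η x' ∂μ) (∫ x', L f x' ∂μ) θ

/-- `ℓ x' x` is a version of the Radon-Nikodym density `dL(x', ·) / dκ(x', ·) (x) ∈ Θ*`, where
`L(x', dx)` is the `Θ*`-valued kernel representing the operator `L`, that is,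
`L f (x') = ∫ f(x) L(x', dx) = ∫ f(x) ℓ(x', x) κ(x', dx)`, evaluated at every `v ∈ Θ`. -/
structure IsDensity {E Θ : Type*} [TopologicalSpace E] [MeasurableSpace E]
    [NormedAddCommGroup Θ] [NormedSpace ℝ Θ] (L : (E →ᵇ ℝ) → (E →ᵇ StrongDual ℝ Θ))
    (κ : Kernel E E) (ℓ : E → E → StrongDual ℝ Θ) : Prop where
  integrable : ∀ (x' : E) (v : Θ), Integrable (fun x => ℓ x' x v) (κ x')
  apply_eq : ∀ (f : E →ᵇ ℝ) (x' : E) (v : Θ), L f x' v = ∫ x, f x * ℓ x' x v ∂κ x'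

/-- `Λ(x) = sup_{x'} ‖ℓ(x', x)‖`, with values in `[0, ∞]`. -/
def supDensity {E Θ : Type*} [NormedAddCommGroup Θ] [NormedSpace ℝ Θ]
    (ℓ : E → E → StrongDual ℝ Θ) (x : E) : ℝ≥0∞ :=
  ⨆ x' : E, ‖ℓ x' x‖ₑ

/-- Universal measurability: measurability up to null sets of every finite measure. -/
def UniversallyMeasurable {E : Type*} [MeasurableSpace E] (u : E → ℝ≥0∞) : Prop :=
  ∀ ρ : Measure E, IsFiniteMeasure ρ → AEMeasurable u ρ

end

end HMMFilter

open HMMFilter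

/-! The error of the filter with the wrong parameter is telescoped through hybrids that follow the
`θ`-filter up to time `k` and the `α`-filter afterwards. Passing from one hybrid to the next changes
only the prediction at time `k + 1`, where `K θ` replaces `K α` on the current filter. As `K α` is
mixing, the `α`-filter contracts this local error by `(1 - ε ^ 2) ^ (n - 1 - k)`, at the price of
the factor `likelihoodRatioBound` of the observation at time `k + 1` (`abs_integral_filter_sub_le`).
The geometric series is summable, so it suffices that the weighted local errors have mean at most `C
* ‖θ - α‖`, with `C` independent of `k` and `θ`.

The local error is a supremum over test functions, and the maximiser depends on the random filter.
With countably many test functions it can be chosen measurably; this cuts the probability space into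
finitely many pieces, each with a deterministic test function. The mean value inequality on the
segment from `α` to `θ` then applies to the sum over the pieces, and its derivative is bounded by
the integral of `supDensity` against the predicted averaged filter, whatever the pieces are
(`lintegral_iSup_integral_sub_le`).

That integral is bounded uniformly in time by a change of measure. The filter is at most a product
of likelihood ratio bounds times the prior law of the signal, and after averaging the product costs
`C₁ ^ (n + 1)`. This geometric growth is compensated by the moment hypothesis, which controls the
moment of order `n + 2` by `C₀ ^ (n + 2)` (`lintegral_comp_filterKernel_le`). -/

namespace HMMFilter

/-! ### Total variation and test functions -/

section TotalVariation

variable {E : Type*} [MeasurableSpace E]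

/-- The truncated difference lives on the part of a Hahn decomposition where `μ` dominates, and
there it is a plain subtraction; the hypothesis is needed for that one set only. -/
theorem measure_sub_univ_le {μ ν : Measure E} [IsFiniteMeasure μ] [IsFiniteMeasure ν] {d : ℝ≥0∞}
    (h : ∀ A, MeasurableSet A → μ A ≤ ν A + d) : (μ - ν) Set.univ ≤ d := by
  obtain ⟨s, hs⟩ := exists_isHahnDecomposition μ ν
  have h0 : (μ - ν) s = 0 := Measure.sub_apply_eq_zero_of_isHahnDecomposition hs
  have h1 : (μ - ν) sᶜ = μ sᶜ - ν sᶜ := by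
    have := congrArg (fun m : Measure E => m Set.univ)
      (Measure.restrict_sub_eq_restrict_sub_restrict (μ := μ) (ν := ν) hs.measurableSet.compl)
    rw [Measure.sub_apply MeasurableSet.univ hs.ge_on_compl] at this
    simpa using this
  rw [← measure_add_measure_compl hs.measurableSet, h0, h1, zero_add]
  exact tsub_le_iff_left.2 (h _ hs.measurableSet.compl)

theorem tvDist_le {μ ν : Measure E} [IsFiniteMeasure μ] [IsFiniteMeasure ν] {d : ℝ≥0∞}
    (h₁ : ∀ A, MeasurableSet A → μ A ≤ ν A + d) (h₂ : ∀ A, MeasurableSet A → ν A ≤ μ A + d) :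
    tvDist μ ν ≤ 2 * d := by
  rw [tvDist, SignedMeasure.totalVariation, Measure.toJordanDecomposition_toSignedMeasure_sub,
    Measure.jordanDecompositionOfToSignedMeasureSub_posPart,
    Measure.jordanDecompositionOfToSignedMeasureSub_negPart, Measure.add_apply, two_mul]
  exact add_le_add (measure_sub_univ_le h₁) (measure_sub_univ_le h₂)

theorem integrable_of_bounded {ν : Measure E} [IsFiniteMeasure ν] {φ : E → ℝ} (hφ : Measurable φ)
    {a b : ℝ} (h : ∀ x, φ x ∈ Set.Icc a b) : Integrable φ ν :=
  Integrable.of_mem_Icc a b hφ.aemeasurable (ae_of_all _ h)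

/-- Layer-cake formula: the levels `t ∈ (0, M]` each contribute an error of at most `d`. -/
theorem integral_le_of_measureReal_le {μ ν : Measure E} [IsFiniteMeasure μ] [IsFiniteMeasure ν]
    {d : ℝ} (h : ∀ A, MeasurableSet A → μ.real A ≤ ν.real A + d)
    {φ : E → ℝ} (hφ : Measurable φ) {M : ℝ} (hM0 : 0 ≤ M)
    (hM : ∀ x, φ x ∈ Set.Icc 0 M) :
    ∫ x, φ x ∂μ ≤ ∫ x, φ x ∂ν + M * d := by
  have key : ∀ (m : Measure E) [IsFiniteMeasure m],
      ∫ x, φ x ∂m = ∫ t in Set.Ioc 0 M, m.real {x | t < φ x} := by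
    intro m _
    rw [Integrable.integral_eq_integral_meas_lt (integrable_of_bounded hφ hM)
      (ae_of_all _ fun x => (hM x).1)]
    refine setIntegral_eq_of_subset_of_forall_sdiff_eq_zero (s := Set.Ioc 0 M) measurableSet_Ioi
      (fun t ht => ht.1) fun t ht => ?_
    have : {x | t < φ x} = ∅ := by
      ext x
      simp only [Set.mem_ofPred_eq, Set.mem_empty_iff_false, iff_false, not_lt]
      refine (hM x).2.trans (le_of_not_ge fun hc => ?_)
      exact ht.2 ⟨ht.1, hc⟩
    simp [this]
  have hint : ∀ (m : Measure E) [IsFiniteMeasure m],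
      IntegrableOn (fun t : ℝ => m.real {x | t < φ x}) (Set.Ioc 0 M) := by
    intro m _
    refine Integrable.of_mem_Icc 0 (m.real Set.univ) ?_ (ae_of_all _ fun t =>
      ⟨measureReal_nonneg, measureReal_mono (Set.subset_univ _)⟩)
    have : Antitone fun t : ℝ => m.real {x | t < φ x} := fun s t hst =>
      measureReal_mono fun x hx => lt_of_le_of_lt hst hx
    exact this.measurable.aemeasurable
  rw [key μ, key ν]
  calc _ ≤ ∫ t in Set.Ioc 0 M, (ν.real {x | t < φ x} + d) :=
        integral_mono (hint μ) ((hint ν).add (integrable_const _))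
          fun t => h _ (measurableSet_lt measurable_const hφ)
    _ = _ := by
        rw [integral_add (hint ν) (integrable_const _)]
        simp [hM0]

/-- Countability makes the worst test function for a random pair of measures measurably selectable,
and `f 0 = 0` keeps the selected difference nonnegative. The functions approximate finite
intersections of complements of basic open sets; the inequality passes to closed sets by decreasing
limits, then to Borel sets by inner regularity. -/
theorem exists_seq_test_functions [TopologicalSpace E] [PolishSpace E] [BorelSpace E] :
    ∃ f : ℕ → E →ᵇ ℝ, f 0 = 0 ∧ (∀ i x, f i x ∈ Set.Icc (0 : ℝ) 1) ∧
      ∀ (μ ν : Measure E) [IsFiniteMeasure μ] [IsFiniteMeasure ν] (d : ℝ),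
        (∀ i, ∫ x, f i x ∂μ ≤ ∫ x, f i x ∂ν + d) →
          ∀ A, MeasurableSet A → μ.real A ≤ ν.real A + d := by
  set B := TopologicalSpace.countableBasis E
  have : Countable B := (TopologicalSpace.countable_countableBasis E).to_subtype
  have hB := TopologicalSpace.isBasis_countableBasis E
  have hF : ∀ t : Finset B, IsClosed (⋂ u ∈ t, (u : Set E)ᶜ) := fun t =>
    isClosed_biInter fun u _ => (hB.isOpen u.2).isClosed_compl
  let g : Finset B × ℕ → E →ᵇ ℝ := fun q =>
    ⟨⟨fun x => ((hF q.1).apprSeq q.2 x : ℝ),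
      NNReal.continuous_coe.comp ((hF q.1).apprSeq q.2).continuous⟩, by
        refine ⟨1, fun x y => ?_⟩
        have h1 : ((hF q.1).apprSeq q.2 x : ℝ) ≤ 1 := mod_cast
          HasOuterApproxClosed.apprSeq_apply_le_one (hF q.1) q.2 x
        have h2 : ((hF q.1).apprSeq q.2 y : ℝ) ≤ 1 := mod_cast
          HasOuterApproxClosed.apprSeq_apply_le_one (hF q.1) q.2 y
        have h3 := NNReal.coe_nonneg ((hF q.1).apprSeq q.2 x)
        have h4 := NNReal.coe_nonneg ((hF q.1).apprSeq q.2 y)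
        change |((hF q.1).apprSeq q.2 x : ℝ) - ((hF q.1).apprSeq q.2 y : ℝ)| ≤ 1
        rw [abs_le]
        constructor <;> linarith⟩
  have hg : ∀ q x, g q x = ((hF q.1).apprSeq q.2 x : ℝ) := fun _ _ => rfl
  obtain ⟨e, he⟩ := exists_surjective_nat (Finset B × ℕ)
  refine ⟨fun i => i.casesOn 0 fun i => g (e i), rfl, fun i x => ?_, ?_⟩
  · cases i with
    | zero => simp
    | succ i =>
      refine ⟨NNReal.coe_nonneg _, ?_⟩
      exact_mod_cast HasOuterApproxClosed.apprSeq_apply_le_one (hF _) _ x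
  intro μ ν _ _ d hd
  have hd' : ∀ q, ∫ x, g q x ∂μ ≤ ∫ x, g q x ∂ν + d := fun q => by
    obtain ⟨i, rfl⟩ := he q; exact hd (i + 1)
  have hlim : ∀ (m : Measure E) [IsFiniteMeasure m] (t : Finset B),
      Tendsto (fun n => ∫ x, g (t, n) x ∂m) atTop (𝓝 (m.real (⋂ u ∈ t, (u : Set E)ᶜ))) := by
    intro m _ t
    have h1 := (ENNReal.tendsto_toReal (measure_ne_top m _)).comp
      (HasOuterApproxClosed.tendsto_lintegral_apprSeq (hF t) m)
    refine h1.congr fun n => ?_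
    simp only [Function.comp, hg]
    rw [integral_eq_lintegral_of_nonneg_ae (ae_of_all _ fun x => NNReal.coe_nonneg _)
      (NNReal.continuous_coe.comp ((hF t).apprSeq n).continuous).aestronglyMeasurable]
    simp
  have h1 : ∀ t : Finset B, μ.real (⋂ u ∈ t, (u : Set E)ᶜ) ≤ ν.real (⋂ u ∈ t, (u : Set E)ᶜ) + d :=
    fun t => le_of_tendsto_of_tendsto' (hlim μ t) ((hlim ν t).add_const d) fun n => hd' (t, n)
  have h2 : ∀ F : Set E, IsClosed F → μ.real F ≤ ν.real F + d := by
    intro F hFc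
    -- A closed set is the intersection, directed over finite subfamilies, of the complements of the
    -- basic open sets that miss it.
    let S : Set B := {u | (u : Set E) ⊆ Fᶜ}
    have hFS : F = ⋂ t : Finset S, ⋂ u ∈ t, ((u : B) : Set E)ᶜ := by
      ext x
      simp only [Set.mem_iInter]
      constructor
      · intro hx t u _ hxu
        exact u.2 hxu hx
      · intro hx
        by_contra hc
        obtain ⟨u, hu, hxu, huF⟩ := hB.exists_subset_of_mem_open (show x ∈ Fᶜ from hc)
          hFc.isOpen_compl
        exact hx {⟨⟨u, hu⟩, huF⟩} ⟨⟨u, hu⟩, huF⟩ (by simp) hxu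
    have hl : ∀ (m : Measure E) [IsFiniteMeasure m], Tendsto (fun t : Finset S =>
        m.real (⋂ u ∈ t, ((u : B) : Set E)ᶜ)) atTop (𝓝 (m.real F)) := by
      intro m _
      conv => enter [3, 1]; rw [hFS]
      refine (ENNReal.tendsto_toReal (measure_ne_top m _)).comp
        (tendsto_measure_iInter_atTop (fun t => ?_) ?_ ⟨∅, measure_ne_top _ _⟩)
      · refine (IsClosed.measurableSet (isClosed_biInter fun (u : S) _ => ?_)).nullMeasurableSet
        exact (hB.isOpen (u : B).2).isClosed_compl
      · intro s t hst
        exact Set.biInter_subset_biInter_left hst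
    refine le_of_tendsto_of_tendsto' (hl μ) ((hl ν).add_const d) fun t => ?_
    have := h1 (t.map (Function.Embedding.subtype _))
    simpa using this
  intro A hA
  refine le_of_forall_pos_le_add fun ε hε => ?_
  obtain ⟨F, hFA, hFc, hlt⟩ := hA.exists_isClosed_lt_add (measure_ne_top μ A)
    (ENNReal.ofReal_pos.2 hε).ne'
  have h3 : μ.real A ≤ μ.real F + ε := by
    have := ENNReal.toReal_mono (by finiteness) hlt.le
    rwa [ENNReal.toReal_add (by finiteness) (by finiteness), ENNReal.toReal_ofReal hε.le] at this
  have h4 := h2 F hFc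
  have h5 : ν.real F ≤ ν.real A := measureReal_mono hFA
  linarith

end TotalVariation

/-! ### The Markov chain and the filter recursion -/

section Chain

variable {E : Type*} [MeasurableSpace E] {μ : Measure E} {κ : Kernel E E} [IsMarkovKernel κ]

theorem map_chainLaw_zero : (chainLaw μ κ).map (fun x => x 0) = μ := by
  have h1 : (fun x : ℕ → E => x 0) =
      (fun z : (i : Finset.Iic 0) → E => z ⟨0, Finset.mem_Iic.2 le_rfl⟩) ∘
        Preorder.frestrictLe (π := fun _ => E) 0 := rfl
  rw [h1, ← Measure.map_map (measurable_pi_apply _) (by fun_prop), chainLaw, Kernel.trajMeasure,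
    Measure.map_comp _ _ (by fun_prop), Kernel.traj_map_frestrictLe, Kernel.partialTraj_self]
  rw [Measure.id_comp, Measure.map_map (measurable_pi_apply _) (by fun_prop)]
  exact Measure.map_id

/-- The Markov property at time `n`, in the form needed for the filter recursion. -/
theorem lintegral_chainLaw_succ [IsProbabilityMeasure μ] (n : ℕ) {F : ((i : Finset.Iic n) → E) → ℝ≥0∞} (hF : Measurable F)
    {f : E → ℝ≥0∞} (hf : Measurable f) :
    ∫⁻ x, F (Preorder.frestrictLe (π := fun _ => E) n x) * f (x (n + 1)) ∂chainLaw μ κ =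
      ∫⁻ x, F (Preorder.frestrictLe (π := fun _ => E) n x) * ∫⁻ z, f z ∂κ (x n)
        ∂chainLaw μ κ := by
  have key := Kernel.map_frestrictLe_trajMeasure_compProd_eq_map_trajMeasure
    (X := fun _ => E) (μ₀ := μ) (a := n) (κ := fun n =>
    κ.comap (fun x : (i : Finset.Iic n) → E => x ⟨n, Finset.mem_Iic.2 le_rfl⟩)
      (measurable_pi_apply _))
  have hm : Measurable fun q : ((i : Finset.Iic n) → E) × E => F q.1 * f q.2 :=
    (hF.comp measurable_fst).mul (hf.comp measurable_snd)
  have h2 := congrArg (fun m => ∫⁻ q, F q.1 * f q.2 ∂m) key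
  rw [Measure.lintegral_compProd hm, lintegral_map hm (by fun_prop),
    lintegral_map _ (by fun_prop)] at h2
  · unfold chainLaw
    rw [← h2]
    refine lintegral_congr fun x => ?_
    exact lintegral_const_mul (μ := κ (x n)) (F (Preorder.frestrictLe (π := fun _ => E) n x)) hf
  · exact hm.lintegral_kernel_prod_right'

end Chain

/-! ### The optimal filter: likelihood bounds, recursion, comparison with the prior law -/

section Filter

variable {E : Type*} [MeasurableSpace E] {μ : Measure E}
  {κ : Kernel E E} [IsMarkovKernel κ] {p : ℕ} {h : E → EuclideanSpace ℝ (Fin p)} {σ : ℝ}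
  {y : ℕ → EuclideanSpace ℝ (Fin p)}

theorem continuous_gaussDensity : Continuous (gaussDensity (p := p) σ) := by
  unfold gaussDensity
  fun_prop

theorem gaussDensity_pos (hσ : 0 < σ) (v : EuclideanSpace ℝ (Fin p)) : 0 < gaussDensity σ v := by
  unfold gaussDensity
  positivity

theorem gaussDensity_le (hσ : 0 < σ) (v : EuclideanSpace ℝ (Fin p)) :
    gaussDensity σ v ≤ (2 * Real.pi * σ ^ 2) ^ (-(p : ℝ) / 2) := by
  unfold gaussDensity
  refine mul_le_of_le_one_right (by positivity) (Real.exp_le_one_iff.2 ?_)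
  rw [neg_div]
  exact neg_nonpos.2 (by positivity)

/-- A bound for the oscillation of the likelihood of the observation `y`, when the observation
function is bounded by `H`. -/
noncomputable def likelihoodRatioBound (σ H : ℝ) (y : EuclideanSpace ℝ (Fin p)) : ℝ :=
  Real.exp (2 * H * (‖y‖ + H) / σ ^ 2)

theorem continuous_likelihoodRatioBound (H : ℝ) :
    Continuous (likelihoodRatioBound (p := p) σ H) := by
  unfold likelihoodRatioBound
  fun_prop

/-- The difference of the squared norms factors into a difference at most `2 * H` and a sum at most
`2 * (‖y‖ + H)`; dividing by `2 * σ ^ 2` gives the exponent of `likelihoodRatioBound`. -/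
theorem gaussDensity_le_mul (hσ : 0 < σ) {H : ℝ} {a b : EuclideanSpace ℝ (Fin p)} (ha : ‖a‖ ≤ H)
    (hb : ‖b‖ ≤ H) (y : EuclideanSpace ℝ (Fin p)) :
    gaussDensity σ (y - a) ≤ likelihoodRatioBound σ H y * gaussDensity σ (y - b) := by
  unfold gaussDensity likelihoodRatioBound
  rw [mul_left_comm, ← Real.exp_add]
  refine mul_le_mul_of_nonneg_left (Real.exp_le_exp.2 ?_) (by positivity)
  have h1 : ‖y - b‖ ≤ ‖y‖ + H := (norm_sub_le _ _).trans (by linarith)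
  have h2 : ‖y - b‖ ≤ ‖y - a‖ + 2 * H := by
    have : y - b = (y - a) + (a - b) := by abel
    rw [this]
    exact (norm_add_le _ _).trans (by linarith [norm_sub_le a b])
  have h4 : ‖y - a‖ ≤ ‖y‖ + H := (norm_sub_le _ _).trans (by linarith)
  have hH : 0 ≤ H := (norm_nonneg a).trans ha
  have h3 : ‖y - b‖ ^ 2 ≤ ‖y - a‖ ^ 2 + 4 * H * (‖y‖ + H) := by
    have e : ‖y - b‖ ^ 2 - ‖y - a‖ ^ 2 = (‖y - b‖ - ‖y - a‖) * (‖y - b‖ + ‖y - a‖) := by ring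
    have : (‖y - b‖ - ‖y - a‖) * (‖y - b‖ + ‖y - a‖) ≤ (2 * H) * (2 * (‖y‖ + H)) := by
      refine mul_le_mul (by linarith) (by linarith) (by positivity) (by positivity)
    linarith
  have e2 : 2 * H * (‖y‖ + H) / σ ^ 2 + -‖y - b‖ ^ 2 / (2 * σ ^ 2) =
      (4 * H * (‖y‖ + H) - ‖y - b‖ ^ 2) / (2 * σ ^ 2) := by
    field_simp
    ring
  rw [e2]
  gcongr
  linarith

theorem measurable_pathLikelihood (hh : Measurable h) (n : ℕ) :
    Measurable fun q : (ℕ → EuclideanSpace ℝ (Fin p)) × (ℕ → E) =>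
      ENNReal.ofReal (∏ k ∈ Finset.Icc 1 n, gaussDensity σ (q.1 k - h (q.2 k))) := by
  refine ENNReal.measurable_ofReal.comp (Finset.measurable_prod _ fun k _ => ?_)
  refine continuous_gaussDensity.measurable.comp ?_
  fun_prop

theorem measurable_pathLikelihood_right (hh : Measurable h) (n : ℕ) :
    Measurable fun x : ℕ → E =>
      ENNReal.ofReal (∏ k ∈ Finset.Icc 1 n, gaussDensity σ (y k - h (x k))) := by
  refine ENNReal.measurable_ofReal.comp (Finset.measurable_prod _ fun k _ => ?_)
  exact continuous_gaussDensity.measurable.comp (by fun_prop)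

theorem lintegral_unnormalizedFilter (hh : Measurable h) (n : ℕ) {f : E → ℝ≥0∞}
    (hf : Measurable f) :
    ∫⁻ z, f z ∂unnormalizedFilter h σ μ κ n y =
      ∫⁻ x, ENNReal.ofReal (∏ k ∈ Finset.Icc 1 n, gaussDensity σ (y k - h (x k))) * f (x n)
        ∂chainLaw μ κ := by
  have hm := measurable_pathLikelihood_right (σ := σ) (y := y) hh n
  rw [unnormalizedFilter, lintegral_map hf (measurable_pi_apply n),
    lintegral_withDensity_eq_lintegral_mul _ hm (g := fun x => f (x n))
      (hf.comp (measurable_pi_apply n))]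
  rfl

theorem unnormalizedFilter_zero : unnormalizedFilter h σ μ κ 0 y = μ := by
  simp [unnormalizedFilter, map_chainLaw_zero]

theorem unnormalizedFilter_succ [IsProbabilityMeasure μ] (hσ : 0 < σ) (hh : Measurable h) (n : ℕ) :
    unnormalizedFilter h σ μ κ (n + 1) y =
      (κ ∘ₘ unnormalizedFilter h σ μ κ n y).withDensity
        fun x => ENNReal.ofReal (gaussDensity σ (y (n + 1) - h x)) := by
  have hg : Measurable fun x => ENNReal.ofReal (gaussDensity σ (y (n + 1) - h x)) :=
    ENNReal.measurable_ofReal.comp (continuous_gaussDensity.measurable.comp (by fun_prop))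
  ext A hA
  have hgA := hg.indicator hA
  rw [withDensity_apply _ hA, ← lintegral_indicator hA,
    Measure.lintegral_bind κ.aemeasurable hgA.aemeasurable,
    lintegral_unnormalizedFilter hh n hgA.lintegral_kernel, ← lintegral_indicator_one hA,
    lintegral_unnormalizedFilter hh (n + 1) (measurable_one.indicator hA)]
  -- The likelihood of the first `n` observations, as a function of the truncated path; `attach`
  -- carries the proof of `k ≤ n`.
  let F : ((i : Finset.Iic n) → E) → ℝ≥0∞ := fun z =>
    ENNReal.ofReal (∏ k ∈ (Finset.Icc 1 n).attach, gaussDensity σ (y k - h (z ⟨k,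
      Finset.mem_Iic.2 (Finset.mem_Icc.1 k.2).2⟩)))
  have hF : Measurable F := by
    refine ENNReal.measurable_ofReal.comp (Finset.measurable_prod _ fun k _ => ?_)
    exact continuous_gaussDensity.measurable.comp (by fun_prop)
  have hFe : ∀ x : ℕ → E, F (Preorder.frestrictLe (π := fun _ => E) n x) =
      ENNReal.ofReal (∏ k ∈ Finset.Icc 1 n, gaussDensity σ (y k - h (x k))) := by
    intro x
    rw [← Finset.prod_attach (Finset.Icc 1 n)]
    rfl
  have := lintegral_chainLaw_succ (μ := μ) (κ := κ) n hF hgA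
  simp only [hFe] at this
  rw [← this]
  refine lintegral_congr fun x => ?_
  rw [Finset.prod_Icc_succ_top (by omega), ENNReal.ofReal_mul, mul_assoc]
  · congr 1
    by_cases hx : x (n + 1) ∈ A <;> simp [hx]
  · exact Finset.prod_nonneg fun k _ => (gaussDensity_pos hσ _).le

theorem unnormalizedFilter_univ_ne_zero [IsProbabilityMeasure μ] (hσ : 0 < σ) (hh : Measurable h) (n : ℕ) :
    unnormalizedFilter h σ μ κ n y Set.univ ≠ 0 := by
  have hm := measurable_pathLikelihood_right (σ := σ) (y := y) hh n
  have := lintegral_unnormalizedFilter (σ := σ) (μ := μ) (κ := κ) (y := y) hh n measurable_one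
  simp only [Pi.one_apply, lintegral_one, mul_one] at this
  rw [this, Ne, lintegral_eq_zero_iff hm]
  intro h0
  obtain ⟨x, hx⟩ := h0.exists
  have : 0 < ∏ k ∈ Finset.Icc 1 n, gaussDensity σ (y k - h (x k)) :=
    Finset.prod_pos fun k _ => gaussDensity_pos hσ _
  simp only [Pi.zero_apply, ENNReal.ofReal_eq_zero] at hx
  exact absurd this (not_lt.2 hx)

theorem unnormalizedFilter_univ_ne_top [IsProbabilityMeasure μ] (hσ : 0 < σ) (hh : Measurable h) (n : ℕ) :
    unnormalizedFilter h σ μ κ n y Set.univ ≠ ∞ := by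
  have := lintegral_unnormalizedFilter (σ := σ) (μ := μ) (κ := κ) (y := y) hh n measurable_one
  simp only [Pi.one_apply, lintegral_one, mul_one] at this
  rw [this]
  refine ((lintegral_mono fun x => ENNReal.ofReal_le_ofReal
    (Finset.prod_le_prod (fun k _ => (gaussDensity_pos hσ _).le)
      fun k _ => gaussDensity_le hσ _)).trans_lt ?_).ne
  rw [lintegral_const, measure_univ, mul_one]
  exact ENNReal.ofReal_lt_top

theorem isProbabilityMeasure_optimalFilter [IsProbabilityMeasure μ] (hσ : 0 < σ) (hh : Measurable h) (n : ℕ) :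
    IsProbabilityMeasure (optimalFilter h σ μ κ n y) := by
  refine ⟨?_⟩
  rw [optimalFilter, Measure.smul_apply, smul_eq_mul]
  exact ENNReal.inv_mul_cancel (unnormalizedFilter_univ_ne_zero hσ hh n)
    (unnormalizedFilter_univ_ne_top hσ hh n)

theorem measurable_optimalFilter [IsProbabilityMeasure μ] (hh : Measurable h) (n : ℕ) :
    Measurable fun y => optimalFilter h σ μ κ n y := by
  have hu : ∀ A, MeasurableSet A → Measurable fun y => unnormalizedFilter h σ μ κ n y A := by
    intro A hA
    have : (fun y => unnormalizedFilter h σ μ κ n y A) = fun y =>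
        ∫⁻ x, ENNReal.ofReal (∏ k ∈ Finset.Icc 1 n, gaussDensity σ (y k - h (x k))) *
          A.indicator 1 (x n) ∂chainLaw μ κ := by
      funext y
      rw [← lintegral_indicator_one hA,
        lintegral_unnormalizedFilter hh n (measurable_one.indicator hA)]
    rw [this]
    refine Measurable.lintegral_prod_right' (f := fun q : (ℕ → EuclideanSpace ℝ (Fin p)) × (ℕ → E)
      => ENNReal.ofReal (∏ k ∈ Finset.Icc 1 n, gaussDensity σ (q.1 k - h (q.2 k))) *
          A.indicator 1 (q.2 n)) ?_
    exact (measurable_pathLikelihood hh n).mul ((measurable_one.indicator hA).comp (by fun_prop))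
  refine Measure.measurable_of_measurable_coe _ fun A hA => ?_
  simp only [optimalFilter, Measure.smul_apply, smul_eq_mul]
  exact (hu _ MeasurableSet.univ).inv.mul (hu A hA)

/-- Any two paths have likelihoods within a factor `C`, so each likelihood is at most `C` times its
mean, which is the normalising constant. -/
theorem optimalFilter_le [IsProbabilityMeasure μ] (hσ : 0 < σ) (hh : Measurable h) {H : ℝ} (hH : ∀ x, ‖h x‖ ≤ H) (n : ℕ) :
    optimalFilter h σ μ κ n y ≤
      ENNReal.ofReal (∏ k ∈ Finset.Icc 1 n, likelihoodRatioBound σ H (y k)) •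
        (chainLaw μ κ).map fun x => x n := by
  refine Measure.le_iff.2 fun A hA => ?_
  set C := ENNReal.ofReal (∏ k ∈ Finset.Icc 1 n, likelihoodRatioBound σ H (y k))
  set W : (ℕ → E) → ℝ≥0∞ := fun x =>
    ENNReal.ofReal (∏ k ∈ Finset.Icc 1 n, gaussDensity σ (y k - h (x k)))
  have hW : Measurable W := measurable_pathLikelihood_right hh n
  have hWle : ∀ x x', W x ≤ C * W x' := by
    intro x x'
    have hC : 0 ≤ ∏ k ∈ Finset.Icc 1 n, likelihoodRatioBound σ H (y k) :=
      Finset.prod_nonneg fun k _ => (Real.exp_pos _).le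
    simp only [W, C]
    rw [← ENNReal.ofReal_mul hC, ← Finset.prod_mul_distrib]
    exact ENNReal.ofReal_le_ofReal (Finset.prod_le_prod (fun k _ => (gaussDensity_pos hσ _).le)
      fun k _ => gaussDensity_le_mul hσ (hH _) (hH _) _)
  have hA' : Measurable fun x : ℕ → E => A.indicator (1 : E → ℝ≥0∞) (x n) :=
    (measurable_one.indicator hA).comp (measurable_pi_apply n)
  have hPA : (chainLaw μ κ).map (fun x => x n) A =
      ∫⁻ x, A.indicator (1 : E → ℝ≥0∞) (x n) ∂chainLaw μ κ := by
    rw [← lintegral_indicator_one hA,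
      lintegral_map (measurable_one.indicator hA) (measurable_pi_apply n)]
  have huniv : unnormalizedFilter h σ μ κ n y Set.univ = ∫⁻ x, W x ∂chainLaw μ κ := by
    have := lintegral_unnormalizedFilter (σ := σ) (μ := μ) (κ := κ) (y := y) hh n measurable_one
    simpa only [Pi.one_apply, lintegral_one, mul_one] using this
  have hle : unnormalizedFilter h σ μ κ n y A ≤
      C * unnormalizedFilter h σ μ κ n y Set.univ * (chainLaw μ κ).map (fun x => x n) A := by
    rw [← lintegral_indicator_one hA,
      lintegral_unnormalizedFilter hh n (measurable_one.indicator hA), hPA, huniv,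
      ← lintegral_const_mul _ hA']
    refine lintegral_mono fun x => mul_le_mul' ?_ le_rfl
    rw [← lintegral_const_mul _ hW]
    calc W x = ∫⁻ _, W x ∂chainLaw μ κ := by simp
      _ ≤ _ := lintegral_mono fun x' => hWle x x'
  rw [optimalFilter, Measure.smul_apply, Measure.smul_apply, smul_eq_mul, smul_eq_mul]
  calc _ ≤ (unnormalizedFilter h σ μ κ n y Set.univ)⁻¹ *
        (C * unnormalizedFilter h σ μ κ n y Set.univ * (chainLaw μ κ).map (fun x => x n) A) := by
        gcongr
    _ = ((unnormalizedFilter h σ μ κ n y Set.univ)⁻¹ * unnormalizedFilter h σ μ κ n y Set.univ) *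
        (C * (chainLaw μ κ).map (fun x => x n) A) := by ring
    _ = _ := by
        rw [ENNReal.inv_mul_cancel (unnormalizedFilter_univ_ne_zero hσ hh n)
          (unnormalizedFilter_univ_ne_top hσ hh n), one_mul]

end Filter

/-! ### Stability of the filter for a mixing kernel -/

section Stability

variable {E : Type*} [MeasurableSpace E]

theorem integral_comp_measure {Ω : Type*} [MeasurableSpace Ω] {κ : Kernel Ω E} {m : Measure Ω}
    {f : E → ℝ} (hf : Integrable f (κ ∘ₘ m)) :
    ∫ x, f x ∂(κ ∘ₘ m) = ∫ x, ∫ z, f z ∂κ x ∂m := by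
  rw [Measure.comp_eq_comp_const_apply] at hf ⊢
  rw [Kernel.integral_comp hf, Kernel.const_apply]

theorem measurable_integral_kernel {Ω : Type*} [MeasurableSpace Ω] {κ : Kernel Ω E}
    {f : E → ℝ} (hf : Measurable f) :
    Measurable fun x => ∫ z, f z ∂κ x :=
  (StronglyMeasurable.integral_kernel hf.stronglyMeasurable).measurable

theorem integral_withDensity_ofReal {m : Measure E} {f g : E → ℝ} (hg : Measurable g)
    (h0 : ∀ x, 0 ≤ g x) :
    ∫ x, f x ∂(m.withDensity fun x => ENNReal.ofReal (g x)) = ∫ x, g x * f x ∂m := by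
  have hm : Measurable fun x => ENNReal.ofReal (g x) := ENNReal.measurable_ofReal.comp hg
  rw [integral_withDensity_eq_integral_toReal_smul hm (ae_of_all _ fun x => ENNReal.ofReal_lt_top)]
  exact integral_congr_ae (ae_of_all _ fun x => by simp [h0 x])

theorem integral_pos_of_pos {m : Measure E} [NeZero m] {f : E → ℝ} (hf : Integrable f m)
    (h0 : ∀ x, 0 < f x) : 0 < ∫ x, f x ∂m := by
  rw [integral_pos_iff_support_of_nonneg (fun x => (h0 x).le) hf]
  have : Function.support f = Set.univ := Set.eq_univ_of_forall fun x => (h0 x).ne'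
  rw [this]
  exact Measure.measure_univ_pos.2 (NeZero.ne m)

theorem integral_mem_Icc {m : Measure E} [IsProbabilityMeasure m] {f : E → ℝ} (hf : Measurable f)
    {a b : ℝ} (h : ∀ x, f x ∈ Set.Icc a b) : ∫ x, f x ∂m ∈ Set.Icc a b := by
  have hi := integrable_of_bounded (ν := m) hf h
  constructor
  · simpa using integral_mono (integrable_const a) hi fun x => (h x).1
  · simpa using integral_mono hi (integrable_const b) fun x => (h x).2

/-- The functions `x ↦ E[g_{k+1}(X_{k+1}) ⋯ g_{k+j}(X_{k+j}) f(X_{k+j}) | X_k = x]` for a Markov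
chain `X` with kernel `κ`. -/
noncomputable def backward (κ : Kernel E E) (g : ℕ → E → ℝ) (f : E → ℝ) : ℕ → ℕ → E → ℝ
  | 0, _ => f
  | j + 1, k => fun x => ∫ z, g (k + 1) z * backward κ g f j (k + 1) z ∂κ x

variable {κ : Kernel E E} {g : ℕ → E → ℝ} {f : E → ℝ} {G : ℝ}

theorem measurable_backward (hg : ∀ k, Measurable (g k)) (hf : Measurable f) (j k : ℕ) :
    Measurable (backward κ g f j k) := by
  induction j generalizing k with
  | zero => exact hf
  | succ j ih => exact measurable_integral_kernel ((hg _).mul (ih _))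

variable [IsMarkovKernel κ]

theorem backward_mem_Icc (hg : ∀ k, Measurable (g k)) (hf : Measurable f)
    (hf1 : ∀ x, f x ∈ Set.Icc (0 : ℝ) 1) (hgG : ∀ k x, g k x ∈ Set.Icc 0 G) (j k : ℕ) (x : E) :
    backward κ g f j k x ∈ Set.Icc 0 (G ^ j) := by
  induction j generalizing k x with
  | zero => simpa [backward] using hf1 x
  | succ j ih =>
    refine integral_mem_Icc ((hg _).mul (measurable_backward hg hf _ _)) fun z => ⟨?_, ?_⟩
    · exact mul_nonneg (hgG _ _).1 (ih _ _).1
    · rw [pow_succ']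
      exact mul_le_mul (hgG _ _).2 (ih _ _).2 (ih _ _).1 ((hgG (k + 1) z).1.trans (hgG _ _).2)

theorem mul_backward_mem_Icc (hg : ∀ k, Measurable (g k)) (hf : Measurable f)
    (hf1 : ∀ x, f x ∈ Set.Icc (0 : ℝ) 1) (hgG : ∀ k x, g k x ∈ Set.Icc 0 G) (j k : ℕ) (x : E) :
    g k x * backward κ g f j k x ∈ Set.Icc 0 (G * G ^ j) :=
  ⟨mul_nonneg (hgG _ _).1 (backward_mem_Icc hg hf hf1 hgG _ _ _).1,
    mul_le_mul (hgG _ _).2 (backward_mem_Icc hg hf hf1 hgG _ _ _).2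
      (backward_mem_Icc hg hf hf1 hgG _ _ _).1 ((hgG k x).1.trans (hgG k x).2)⟩

theorem integrable_mul_backward {m : Measure E} [IsFiniteMeasure m]
    (hg : ∀ k, Measurable (g k)) (hf : Measurable f)
    (hf1 : ∀ x, f x ∈ Set.Icc (0 : ℝ) 1) (hgG : ∀ k x, g k x ∈ Set.Icc 0 G) (j k : ℕ) :
    Integrable (fun x => g k x * backward κ g f j k x) m :=
  integrable_of_bounded ((hg k).mul (measurable_backward hg hf j k))
    (mul_backward_mem_Icc hg hf hf1 hgG j k)

theorem backward_one_pos (hg : ∀ k, Measurable (g k)) (hg0 : ∀ k x, 0 < g k x)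
    (hgG : ∀ k x, g k x ≤ G) (j k : ℕ) (x : E) : 0 < backward κ g (fun _ => 1) j k x := by
  induction j generalizing k x with
  | zero => exact one_pos
  | succ j ih =>
    exact integral_pos_of_pos (integrable_mul_backward hg measurable_const (fun _ => by simp)
      (fun k x => ⟨(hg0 k x).le, hgG k x⟩) _ _) fun z => mul_pos (hg0 _ _) (ih _ _)

/-! ### Contraction of the backward functions under mixing -/

section Mixing

variable {ε : ℝ} {lam : Measure E}

theorem mul_integral_le_of_mixing (hε : 0 < ε)
    (hmix : ∀ (x : E) (A : Set E), MeasurableSet A → ENNReal.ofReal ε * lam A ≤ κ x A)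
    {φ : E → ℝ} (hφ : Measurable φ) {M : ℝ} (hM : ∀ x, φ x ∈ Set.Icc 0 M) (x : E) :
    ε * ∫ z, φ z ∂lam ≤ ∫ z, φ z ∂κ x := by
  have h1 : ENNReal.ofReal ε • lam ≤ κ x := Measure.le_iff.2 fun A hA => by
    simpa using hmix x A hA
  have := integral_mono_measure h1 (ae_of_all _ fun z => (hM z).1) (integrable_of_bounded hφ hM)
  rwa [integral_smul_measure, ENNReal.toReal_ofReal hε.le] at this

omit [IsMarkovKernel κ] in
theorem integral_le_mul_of_mixing [IsFiniteMeasure lam] (hε : 0 < ε)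
    (hmix : ∀ (x : E) (A : Set E), MeasurableSet A → κ x A ≤ ENNReal.ofReal (1 / ε) * lam A)
    {φ : E → ℝ} (hφ : Measurable φ) {M : ℝ} (hM : ∀ x, φ x ∈ Set.Icc 0 M) (x : E) :
    ∫ z, φ z ∂κ x ≤ 1 / ε * ∫ z, φ z ∂lam := by
  have h1 : κ x ≤ ENNReal.ofReal (1 / ε) • lam := Measure.le_iff.2 fun A hA => by
    simpa using hmix x A hA
  have := integral_mono_measure h1 (ae_of_all _ fun z => (hM z).1)
    ((integrable_of_bounded hφ hM).smul_measure ENNReal.ofReal_ne_top)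
  rwa [integral_smul_measure, ENNReal.toReal_ofReal (by positivity)] at this

variable [IsFiniteMeasure lam] (hε : 0 < ε) (hε1 : ε ≤ 1)
  (hmix : ∀ (x : E) (A : Set E), MeasurableSet A →
    ENNReal.ofReal ε * lam A ≤ κ x A ∧ κ x A ≤ ENNReal.ofReal (1 / ε) * lam A)
  (hg : ∀ k, Measurable (g k)) (hg0 : ∀ k x, 0 < g k x) (hgG : ∀ k x, g k x ≤ G)

include hε hε1 hmix hg hg0 hgG

/-- Integrals against `κ x` and `κ x'` are both compared with the one against `lam`, at the cost of
a factor `1 / ε` each. -/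
theorem backward_one_le (j k : ℕ) (x x' : E) :
    backward κ g (fun _ => 1) j k x ≤ 1 / ε ^ 2 * backward κ g (fun _ => 1) j k x' := by
  cases j with
  | zero =>
    simp only [backward, mul_one]
    exact (one_le_div (by positivity)).2 (pow_le_one₀ hε.le hε1)
  | succ j =>
    have hm : Measurable fun z => g (k + 1) z * backward κ g (fun _ => 1) j (k + 1) z :=
      (hg _).mul (measurable_backward hg measurable_const _ _)
    have hM := mul_backward_mem_Icc (κ := κ) hg (measurable_const (a := (1 : ℝ)))
      (fun _ => by simp)
      (fun k x => ⟨(hg0 k x).le, hgG k x⟩) j (k + 1)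
    have h1 := integral_le_mul_of_mixing hε (fun x A hA => (hmix x A hA).2) hm hM x
    have h2 := mul_integral_le_of_mixing hε (fun x A hA => (hmix x A hA).1) hm hM x'
    refine h1.trans ?_
    calc _ = 1 / ε ^ 2 * (ε * ∫ z, g (k + 1) z * backward κ g (fun _ => 1) j (k + 1) z ∂lam) := by
          field_simp
      _ ≤ _ := mul_le_mul_of_nonneg_left h2 (by positivity)

-- The ratio of the two backward functions lies in an interval `[a, b]` that shrinks by the factor
-- `1 - ε ^ 2` at each step. The nonnegative functions `F - a * H` and `b * H - F` keep at least `ε`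
-- times their `lam`-integral under `κ x`, while that of `H` grows by at most `1 / ε`. Hence `a`
-- rises by `ε ^ 2 * (P - a * I) / I` and `b` falls by `ε ^ 2 * (b * I - P) / I`, in total `ε ^ 2 *
-- (b - a)`.
omit hε1 in
theorem exists_backward_bounds (hf : Measurable f) (hf1 : ∀ x, f x ∈ Set.Icc (0 : ℝ) 1) (j k : ℕ) :
    ∃ a b : ℝ, b - a = (1 - ε ^ 2) ^ j ∧ ∀ x,
      a * backward κ g (fun _ => 1) j k x ≤ backward κ g f j k x ∧
        backward κ g f j k x ≤ b * backward κ g (fun _ => 1) j k x := by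
  induction j generalizing k with
  | zero => exact ⟨0, 1, by simp, fun x => by simpa [backward] using hf1 x⟩
  | succ j ih =>
    obtain ⟨a, b, hab, hx⟩ := ih (k + 1)
    have hgG' : ∀ k x, g k x ∈ Set.Icc 0 G := fun k x => ⟨(hg0 k x).le, hgG k x⟩
    set F := fun z => g (k + 1) z * backward κ g f j (k + 1) z
    set H := fun z => g (k + 1) z * backward κ g (fun _ => 1) j (k + 1) z
    have hFm : Measurable F := (hg _).mul (measurable_backward hg hf _ _)
    have hHm : Measurable H := (hg _).mul (measurable_backward hg measurable_const _ _)
    have hFM := mul_backward_mem_Icc (κ := κ) hg hf hf1 hgG' j (k + 1)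
    have hHM := mul_backward_mem_Icc (κ := κ) hg (measurable_const (a := (1 : ℝ)))
      (fun _ => by simp) hgG' j (k + 1)
    have hFi : ∀ (m : Measure E) [IsFiniteMeasure m], Integrable F m := fun m _ =>
      integrable_of_bounded hFm hFM
    have hHi : ∀ (m : Measure E) [IsFiniteMeasure m], Integrable H m := fun m _ =>
      integrable_of_bounded hHm hHM
    have hlo : ∀ z, 0 ≤ F z - a * H z := fun z => by
      have := mul_le_mul_of_nonneg_left (hx z).1 (hg0 (k + 1) z).le
      simp only [F, H]
      linarith
    have hhi : ∀ z, 0 ≤ b * H z - F z := fun z => by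
      have := mul_le_mul_of_nonneg_left (hx z).2 (hg0 (k + 1) z).le
      simp only [F, H]
      linarith
    have hbd : ∀ z, |a * H z| ≤ |a| * (G * G ^ j) ∧ |b * H z| ≤ |b| * (G * G ^ j) := fun z => by
      have := abs_of_nonneg (show 0 ≤ H z from (hHM z).1)
      rw [abs_mul a, abs_mul b, this]
      exact ⟨mul_le_mul_of_nonneg_left (hHM z).2 (abs_nonneg a),
        mul_le_mul_of_nonneg_left (hHM z).2 (abs_nonneg b)⟩
    have hint : ∀ (m : Measure E) [IsFiniteMeasure m],
        ∫ z, (F z - a * H z) ∂m = ∫ z, F z ∂m - a * ∫ z, H z ∂m ∧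
        ∫ z, (b * H z - F z) ∂m = b * ∫ z, H z ∂m - ∫ z, F z ∂m := fun m _ => by
      rw [integral_sub (hFi m) ((hHi m).const_mul a), integral_sub ((hHi m).const_mul b) (hFi m),
        integral_const_mul, integral_const_mul]
      exact ⟨rfl, rfl⟩
    have h1 : ∀ x, ε * (∫ z, F z ∂lam - a * ∫ z, H z ∂lam) ≤
        ∫ z, F z ∂κ x - a * ∫ z, H z ∂κ x := fun x => by
      rw [← (hint lam).1, ← (hint (κ x)).1]
      refine mul_integral_le_of_mixing hε (fun x A hA => (hmix x A hA).1)
        (hFm.sub (hHm.const_mul a)) (M := G * G ^ j + |a| * (G * G ^ j))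
        (fun z => ⟨hlo z, ?_⟩) x
      change F z - a * H z ≤ _
      linarith [(hFM z).2, neg_abs_le (a * H z), (hbd z).1]
    have h2 : ∀ x, ε * (b * ∫ z, H z ∂lam - ∫ z, F z ∂lam) ≤
        b * ∫ z, H z ∂κ x - ∫ z, F z ∂κ x := fun x => by
      rw [← (hint lam).2, ← (hint (κ x)).2]
      refine mul_integral_le_of_mixing hε (fun x A hA => (hmix x A hA).1)
        ((hHm.const_mul b).sub hFm) (M := |b| * (G * G ^ j))
        (fun z => ⟨hhi z, ?_⟩) x
      change b * H z - F z ≤ _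
      linarith [(hFM z).1, le_abs_self (b * H z), (hbd z).2]
    have h3 : ∀ x, ∫ z, H z ∂κ x ≤ 1 / ε * ∫ z, H z ∂lam :=
      integral_le_mul_of_mixing hε (fun x A hA => (hmix x A hA).2) hHm hHM
    have hpos : ∀ x, 0 < ∫ z, H z ∂κ x := fun x => backward_one_pos hg hg0 hgG (j + 1) k x
    rcases isEmpty_or_nonempty E with hE | ⟨⟨x0⟩⟩
    · exact ⟨0, (1 - ε ^ 2) ^ (j + 1), by simp, fun x => hE.elim x⟩
    have hI : 0 < ∫ z, H z ∂lam := by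
      have := (hpos x0).trans_le (h3 x0)
      exact pos_of_mul_pos_right this (by positivity)
    set I := ∫ z, H z ∂lam
    set P := ∫ z, F z ∂lam
    have hP : 0 ≤ P - a * I := by
      rw [← (hint lam).1]; exact integral_nonneg hlo
    have hQ : 0 ≤ b * I - P := by
      rw [← (hint lam).2]; exact integral_nonneg hhi
    have h4 : ∀ x, ε ^ 2 * (∫ z, H z ∂κ x) / I ≤ ε := fun x => by
      rw [div_le_iff₀ hI]
      calc _ ≤ ε ^ 2 * (1 / ε * I) := mul_le_mul_of_nonneg_left (h3 x) (by positivity)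
        _ = ε * I := by field_simp
    refine ⟨a + ε ^ 2 * (P - a * I) / I, b - ε ^ 2 * (b * I - P) / I, ?_, fun x => ⟨?_, ?_⟩⟩
    · rw [pow_succ (1 - ε ^ 2), ← hab]
      field_simp
      ring
    · change (a + ε ^ 2 * (P - a * I) / I) * (∫ z, H z ∂κ x) ≤ ∫ z, F z ∂κ x
      have := mul_le_mul_of_nonneg_right (h4 x) hP
      have e : (a + ε ^ 2 * (P - a * I) / I) * (∫ z, H z ∂κ x) =
        a * (∫ z, H z ∂κ x) + ε ^ 2 * (∫ z, H z ∂κ x) / I * (P - a * I) := by ring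
      linarith [h1 x]
    · change ∫ z, F z ∂κ x ≤ (b - ε ^ 2 * (b * I - P) / I) * (∫ z, H z ∂κ x)
      have := mul_le_mul_of_nonneg_right (h4 x) hQ
      have e : (b - ε ^ 2 * (b * I - P) / I) * (∫ z, H z ∂κ x) =
        b * (∫ z, H z ∂κ x) - ε ^ 2 * (∫ z, H z ∂κ x) / I * (b * I - P) := by ring
      linarith [h2 x]

end Mixing

/-- With `r` the ratio under `m'`, the function `F - r * H` has zero `m'`-integral and is bounded by
`(b - a) * H`, hence by `T = (b - a) * (C * I)`. Its `m`-integral is thus at most `2 * T * d` in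
absolute value, and dividing by `I` gives the claim. -/
theorem abs_div_integral_sub_le {m m' : Measure E} [IsProbabilityMeasure m]
    [IsProbabilityMeasure m'] {d : ℝ} (hd : ∀ A, MeasurableSet A → m.real A ≤ m'.real A + d)
    {F H : E → ℝ} (hF : Measurable F) (hH : Measurable H) {B C a b : ℝ}
    (hHB : ∀ x, H x ≤ B) (hH0 : ∀ x, 0 < H x) (hHC : ∀ x x', H x ≤ C * H x')
    (hab : ∀ x, a * H x ≤ F x ∧ F x ≤ b * H x) :
    |(∫ x, F x ∂m) / (∫ x, H x ∂m) - (∫ x, F x ∂m') / (∫ x, H x ∂m')| ≤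
      2 * C * (b - a) * d := by
  have hHM : ∀ x, H x ∈ Set.Icc 0 B := fun x => ⟨(hH0 x).le, hHB x⟩
  have hHi : ∀ (m : Measure E) [IsFiniteMeasure m], Integrable H m := fun m _ =>
    integrable_of_bounded hH hHM
  have hFi : ∀ (m : Measure E) [IsFiniteMeasure m], Integrable F m := fun m _ => by
    refine integrable_of_bounded hF (a := -(|a| * B)) (b := |b| * B) fun x => ⟨?_, ?_⟩
    · refine le_trans ?_ (hab x).1
      refine (neg_le_neg ?_).trans (neg_abs_le _)
      rw [abs_mul, abs_of_pos (hH0 x)]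
      exact mul_le_mul_of_nonneg_left (hHB x) (abs_nonneg a)
    · refine (hab x).2.trans ((le_abs_self _).trans ?_)
      rw [abs_mul, abs_of_pos (hH0 x)]
      exact mul_le_mul_of_nonneg_left (hHB x) (abs_nonneg b)
  have hI : 0 < ∫ x, H x ∂m := integral_pos_of_pos (hHi m) hH0
  have hI' : 0 < ∫ x, H x ∂m' := integral_pos_of_pos (hHi m') hH0
  set I := ∫ x, H x ∂m
  set I' := ∫ x, H x ∂m'
  set r := (∫ x, F x ∂m') / I'
  have hra : a ≤ r := by
    rw [le_div_iff₀ hI', ← integral_const_mul]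
    exact integral_mono ((hHi m').const_mul a) (hFi m') fun x => (hab x).1
  have hrb : r ≤ b := by
    rw [div_le_iff₀ hI', ← integral_const_mul]
    exact integral_mono (hFi m') ((hHi m').const_mul b) fun x => (hab x).2
  have hHI : ∀ x, H x ≤ C * I := fun x => by
    rw [← integral_const_mul]
    simpa using integral_mono (integrable_const (H x)) ((hHi m).const_mul C) (hHC x)
  set T := (b - a) * (C * I)
  have hφ : ∀ x, |F x - r * H x| ≤ T := fun x => by
    have h1 : (b - a) * H x ≤ T := mul_le_mul_of_nonneg_left (hHI x) (by linarith)
    have h2 := mul_le_mul_of_nonneg_right hra (hH0 x).le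
    have h3 := mul_le_mul_of_nonneg_right hrb (hH0 x).le
    rw [abs_le]
    constructor <;> linarith [(hab x).1, (hab x).2]
  have hφm : Measurable fun x => F x - r * H x := hF.sub (hH.const_mul r)
  have hint : ∀ (m : Measure E) [IsFiniteMeasure m],
      ∫ x, (F x - r * H x) ∂m = ∫ x, F x ∂m - r * ∫ x, H x ∂m := fun m _ => by
    rw [integral_sub (hFi m) ((hHi m).const_mul r), integral_const_mul]
  have hφi : ∀ (m : Measure E) [IsFiniteMeasure m], Integrable (fun x => F x - r * H x) m :=
    fun m _ => (hFi m).sub ((hHi m).const_mul r)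
  have h0 : ∫ x, (F x - r * H x) ∂m' = 0 := by
    rw [hint m']
    change _ - (∫ x, F x ∂m') / I' * I' = 0
    rw [div_mul_cancel₀ _ hI'.ne', sub_self]
  have hT : 0 ≤ T := by
    obtain ⟨x⟩ := Measure.nonempty_of_neZero m
    exact (abs_nonneg _).trans (hφ x)
  -- Adding `T` makes the function take values in `[0, 2 * T]`; both signs are treated to obtain the
  -- absolute value.
  have h1 := integral_le_of_measureReal_le hd (φ := fun x => T + (F x - r * H x))
    (measurable_const.add hφm) (M := 2 * T) (by linarith) fun x =>
      ⟨by linarith [(abs_le.1 (hφ x)).1], by linarith [(abs_le.1 (hφ x)).2]⟩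
  have h2 := integral_le_of_measureReal_le hd (φ := fun x => T - (F x - r * H x))
    (measurable_const.sub hφm) (M := 2 * T) (by linarith) fun x =>
      ⟨by linarith [(abs_le.1 (hφ x)).2], by linarith [(abs_le.1 (hφ x)).1]⟩
  rw [integral_add (integrable_const _) (hφi m), integral_add (integrable_const _) (hφi m'),
    h0] at h1
  rw [integral_sub (integrable_const _) (hφi m), integral_sub (integrable_const _) (hφi m'),
    h0] at h2
  simp only [integral_const, probReal_univ, one_smul] at h1 h2
  have h3 : (∫ x, F x ∂m) / I - r = (∫ x, (F x - r * H x) ∂m) / I := by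
    rw [hint m, sub_div, mul_div_cancel_right₀ _ hI.ne']
  rw [h3, abs_div, abs_of_pos hI, div_le_iff₀ hI, abs_le]
  have e : 2 * C * (b - a) * d * I = 2 * T * d := by simp only [T]; ring
  rw [e]
  constructor <;> linarith

/-- The sequence of probability measures `π` is obtained from `π 0` by alternating the transitions
of the kernel `κ` and the Bayes rule for the likelihoods `g`. -/
def IsFilterSequence (κ : Kernel E E) (g : ℕ → E → ℝ) (π : ℕ → Measure E) : Prop :=
  ∀ k, ∃ s : ℝ≥0∞, s ≠ 0 ∧ s ≠ ∞ ∧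
    π (k + 1) = s • (κ ∘ₘ π k).withDensity fun x => ENNReal.ofReal (g (k + 1) x)

omit [IsMarkovKernel κ] in
theorem IsFilterSequence.integral_div_integral {π : ℕ → Measure E} (hπ : IsFilterSequence κ g π)
    (hg : ∀ k, Measurable (g k)) (hg0 : ∀ k x, 0 < g k x) (k : ℕ) (F H : E → ℝ) :
    (∫ x, F x ∂π (k + 1)) / (∫ x, H x ∂π (k + 1)) =
      (∫ x, g (k + 1) x * F x ∂(κ ∘ₘ π k)) / (∫ x, g (k + 1) x * H x ∂(κ ∘ₘ π k)) := by
  obtain ⟨s, hs0, hs, h⟩ := hπ k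
  rw [h, integral_smul_measure, integral_smul_measure,
    integral_withDensity_ofReal (hg _) fun x => (hg0 _ x).le,
    integral_withDensity_ofReal (hg _) fun x => (hg0 _ x).le, smul_eq_mul, smul_eq_mul,
    mul_div_mul_left _ _ (ENNReal.toReal_ne_zero.2 ⟨hs0, hs⟩)]

/-- The filter for `κ` forgets exponentially fast the local errors made by the filter for another
kernel `κ'`. -/
theorem abs_integral_filter_sub_le {ε : ℝ} {lam : Measure E} [IsFiniteMeasure lam]
    (hε : 0 < ε) (hε1 : ε ≤ 1)
    (hmix : ∀ (x : E) (A : Set E), MeasurableSet A →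
      ENNReal.ofReal ε * lam A ≤ κ x A ∧ κ x A ≤ ENNReal.ofReal (1 / ε) * lam A)
    (hg : ∀ k, Measurable (g k)) (hg0 : ∀ k x, 0 < g k x) (hgG : ∀ k x, g k x ≤ G)
    {c : ℕ → ℝ} (hc : ∀ k, 0 ≤ c k) (hgc : ∀ k x x', g k x ≤ c k * g k x')
    {κ' : Kernel E E} [IsMarkovKernel κ'] {π π' : ℕ → Measure E} [∀ k, IsProbabilityMeasure (π k)]
    [∀ k, IsProbabilityMeasure (π' k)] (hπ : IsFilterSequence κ g π)
    (hπ' : IsFilterSequence κ' g π') (h0 : π' 0 = π 0) {d : ℕ → ℝ}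
    (hd : ∀ k A, MeasurableSet A → (κ' ∘ₘ π' k).real A ≤ (κ ∘ₘ π' k).real A + d k)
    (hf : Measurable f) (hf1 : ∀ x, f x ∈ Set.Icc (0 : ℝ) 1) (n : ℕ) :
    |∫ x, f x ∂π' n - ∫ x, f x ∂π n| ≤
      ∑ k ∈ Finset.range n, 2 / ε ^ 2 * (1 - ε ^ 2) ^ (n - 1 - k) * (c (k + 1) * d k) := by
  -- `R j k m` is the mean of `f` under the `κ`-filter at time `k + j` started from `m` at time `k`.
  let R : ℕ → ℕ → Measure E → ℝ := fun j k m =>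
    (∫ x, backward κ g f j k x ∂m) / ∫ x, backward κ g (fun _ => 1) j k x ∂m
  have hgG' : ∀ k x, g k x ∈ Set.Icc 0 G := fun k x => ⟨(hg0 k x).le, hgG k x⟩
  have h1 : ∀ x : E, (fun _ : E => (1 : ℝ)) x ∈ Set.Icc (0 : ℝ) 1 := fun x => by simp
  have hR : ∀ j k (m : Measure E) [IsProbabilityMeasure m], R (j + 1) k m =
      (∫ x, g (k + 1) x * backward κ g f j (k + 1) x ∂(κ ∘ₘ m)) /
        ∫ x, g (k + 1) x * backward κ g (fun _ => 1) j (k + 1) x ∂(κ ∘ₘ m) := by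
    intro j k m _
    rw [integral_comp_measure (integrable_mul_backward hg hf hf1 hgG' _ _),
      integral_comp_measure (integrable_mul_backward hg measurable_const h1 hgG' _ _)]
    rfl
  have step : ∀ {κ' : Kernel E E} [IsMarkovKernel κ'] {π' : ℕ → Measure E}
      [∀ k, IsProbabilityMeasure (π' k)] (_ : IsFilterSequence κ' g π') {d : ℕ → ℝ}
      (_ : ∀ k A, MeasurableSet A → (κ' ∘ₘ π' k).real A ≤ (κ ∘ₘ π' k).real A + d k) (j k : ℕ),
      |R j (k + 1) (π' (k + 1)) - R (j + 1) k (π' k)| ≤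
        2 / ε ^ 2 * (1 - ε ^ 2) ^ j * (c (k + 1) * d k) := by
    intro κ' _ π' _ hπ' d hd j k
    rw [hR, show R j (k + 1) (π' (k + 1)) = _ from hπ'.integral_div_integral hg hg0 k _ _]
    obtain ⟨a, b, hab, hx⟩ := exists_backward_bounds hε hmix hg hg0 hgG hf hf1 j (k + 1)
    refine (abs_div_integral_sub_le (hd k) ((hg (k + 1)).mul (measurable_backward hg hf j (k + 1)))
      ((hg (k + 1)).mul (measurable_backward hg measurable_const j (k + 1)))
      (C := c (k + 1) * (1 / ε ^ 2)) (a := a) (b := b)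
      (fun x => (mul_backward_mem_Icc hg measurable_const h1 hgG' j (k + 1) x).2)
      (fun x => mul_pos (hg0 _ _) (backward_one_pos hg hg0 hgG _ _ _)) (fun x x' => ?_)
      (fun x => ⟨?_, ?_⟩)).trans (le_of_eq ?_)
    · calc _ ≤ (c (k + 1) * g (k + 1) x') *
            (1 / ε ^ 2 * backward κ g (fun _ => 1) j (k + 1) x') :=
            mul_le_mul (hgc _ _ _) (backward_one_le hε hε1 hmix hg hg0 hgG _ _ _ _)
              (backward_one_pos hg hg0 hgG _ _ _).le (mul_nonneg (hc _) (hg0 _ _).le)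
        _ = _ := by simp only [Pi.mul_apply]; ring
    · have := mul_le_mul_of_nonneg_left (hx x).1 (hg0 (k + 1) x).le
      simp only [Pi.mul_apply]
      linarith
    · have := mul_le_mul_of_nonneg_left (hx x).2 (hg0 (k + 1) x).le
      simp only [Pi.mul_apply]
      linarith
    · rw [hab]
      ring
  -- Telescoping over the time `i` at which the hybrid switches to `κ`; it is stated for a general
  -- kernel so that it also applies to `κ` itself.
  have tele : ∀ {κ' : Kernel E E} [IsMarkovKernel κ'] {π' : ℕ → Measure E}
      [∀ k, IsProbabilityMeasure (π' k)] (_ : IsFilterSequence κ' g π') {d : ℕ → ℝ}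
      (_ : ∀ k A, MeasurableSet A → (κ' ∘ₘ π' k).real A ≤ (κ ∘ₘ π' k).real A + d k),
      |∫ x, f x ∂π' n - R n 0 (π' 0)| ≤
        ∑ k ∈ Finset.range n, 2 / ε ^ 2 * (1 - ε ^ 2) ^ (n - 1 - k) * (c (k + 1) * d k) := by
    intro κ' _ π' _ hπ' d hd
    have h2 : ∀ i ≤ n, |R (n - i) i (π' i) - R n 0 (π' 0)| ≤
        ∑ k ∈ Finset.range i, 2 / ε ^ 2 * (1 - ε ^ 2) ^ (n - 1 - k) * (c (k + 1) * d k) := by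
      intro i
      induction i with
      | zero => simp
      | succ i ih =>
        intro hi
        have h3 := step hπ' hd (n - 1 - i) i
        have e1 : n - 1 - i = n - (i + 1) := by omega
        have e2 : n - 1 - i + 1 = n - i := by omega
        rw [e2] at h3
        rw [Finset.sum_range_succ, ← e1]
        refine (abs_sub_le _ (R (n - i) i (π' i)) _).trans ?_
        linarith [ih (by omega)]
    have h4 := h2 n le_rfl
    simp only [Nat.sub_self, R, backward] at h4
    simpa [R] using h4
  -- For `κ` there is no local error, so its filter mean is exactly `R n 0 (π 0)`.
  have hα := tele hπ (d := fun _ => 0) fun k A _ => by simp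
  have hθ := tele hπ' hd
  simp only [mul_zero, Finset.sum_const_zero] at hα
  have e : ∫ x, f x ∂π n = R n 0 (π' 0) := by
    rw [h0]
    exact sub_eq_zero.1 (abs_nonpos_iff.1 hα)
  rw [e]
  exact hθ

end Stability

/-! ### Lipschitz dependence of the one-step prediction on the parameter -/

section Derivative

/-- A measurable modification is raised to `∞` on a measurable null set containing the exceptional
points; this gives a measurable majorant of `supDensity` with the same integral. -/
theorem exists_measurable_ge_lintegral_eq {E : Type*} [MeasurableSpace E] {ν : Measure E}
    {u : E → ℝ≥0∞} (hu : AEMeasurable u ν) :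
    ∃ u' : E → ℝ≥0∞, Measurable u' ∧ u ≤ u' ∧ ∫⁻ x, u' x ∂ν = ∫⁻ x, u x ∂ν := by
  obtain ⟨w, hw, huw⟩ := hu
  set S := toMeasurable ν {x | u x ≠ w x}
  have hS : ν S = 0 := by rw [measure_toMeasurable]; exact huw
  refine ⟨fun x => S.indicator (fun _ => ∞) x + w x,
    (measurable_const.indicator (measurableSet_toMeasurable _ _)).add hw, fun x => ?_, ?_⟩
  · by_cases hx : u x = w x
    · rw [hx]; exact le_add_self
    · have : x ∈ S := subset_toMeasurable _ _ hx
      simp [this]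
  · rw [lintegral_add_right _ hw, lintegral_indicator (measurableSet_toMeasurable _ _),
      setLIntegral_measure_zero _ _ hS, zero_add]
    exact (lintegral_congr_ae huw).symm

theorem exists_measurable_argmax {Ω : Type*} [MeasurableSpace Ω] {u : ℕ → Ω → ℝ}
    (hu : ∀ i, Measurable (u i)) (n : ℕ) :
    ∃ j : Ω → ℕ, Measurable j ∧ (∀ ω, j ω ≤ n) ∧ ∀ ω, ∀ i ≤ n, u i ω ≤ u (j ω) ω := by
  induction n with
  | zero =>
    exact ⟨fun _ => 0, measurable_const, fun _ => le_rfl, fun ω i hi => by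
      rw [Nat.le_zero.1 hi]⟩
  | succ n ih =>
    obtain ⟨j, hj, hjn, hmax⟩ := ih
    have hm : Measurable fun ω => u (j ω) ω := by
      have : Measurable fun q : ℕ × Ω => u q.1 q.2 := measurable_from_prod_countable_right hu
      exact this.comp (hj.prodMk measurable_id)
    classical
    refine ⟨fun ω => if u (j ω) ω < u (n + 1) ω then n + 1 else j ω,
      Measurable.ite (measurableSet_lt hm (hu _)) measurable_const hj, fun ω => ?_,
      fun ω i hi => ?_⟩
    · dsimp only
      split_ifs
      · exact le_rfl
      · exact (hjn ω).trans n.le_succ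
    · rcases Nat.le_succ_iff.1 hi with hi | rfl <;> dsimp only
      · split_ifs with hlt
        · exact (hmax ω i hi).trans hlt.le
        · exact hmax ω i hi
      · split_ifs with hlt
        · exact le_rfl
        · exact not_lt.1 hlt

variable {E Θ : Type*} [TopologicalSpace E] [MeasurableSpace E]
  [NormedAddCommGroup Θ] [NormedSpace ℝ Θ]

theorem enorm_apply_le_lintegral_supDensity {L : (E →ᵇ ℝ) → (E →ᵇ StrongDual ℝ Θ)}
    {κ : Kernel E E} {ℓ : E → E → StrongDual ℝ Θ} (hℓ : IsDensity L κ ℓ) {f : E →ᵇ ℝ}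
    (hf : ∀ x, f x ∈ Set.Icc (0 : ℝ) 1) (x' : E) :
    ‖L f x'‖ₑ ≤ ∫⁻ x, supDensity ℓ x ∂κ x' := by
  rcases eq_or_ne (∫⁻ x, supDensity ℓ x ∂κ x') ∞ with htop | htop
  · rw [htop]; exact le_top
  have key : ∀ v : Θ, ‖L f x' v‖ₑ ≤ (∫⁻ x, supDensity ℓ x ∂κ x') * ‖v‖ₑ := fun v => by
    rw [hℓ.apply_eq f x' v, ← lintegral_mul_const' _ _ enorm_ne_top]
    refine (enorm_integral_le_lintegral_enorm _).trans (lintegral_mono fun x => ?_)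
    have h1 : ‖f x‖ₑ ≤ 1 := by
      rw [← ofReal_norm, Real.norm_of_nonneg (hf x).1]
      exact ENNReal.ofReal_le_one.2 (hf x).2
    calc ‖f x * ℓ x' x v‖ₑ = ‖f x‖ₑ * ‖ℓ x' x v‖ₑ := enorm_mul _ _
      _ ≤ 1 * (‖ℓ x' x‖ₑ * ‖v‖ₑ) := mul_le_mul' h1 ((ℓ x' x).le_opENorm v)
      _ ≤ supDensity ℓ x * ‖v‖ₑ := by
          rw [one_mul]
          exact mul_le_mul' (le_iSup (fun x' => ‖ℓ x' x‖ₑ) x') le_rfl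
  rw [← ofReal_norm, ← ENNReal.ofReal_toReal htop]
  refine ENNReal.ofReal_le_ofReal (ContinuousLinearMap.opNorm_le_bound _ ENNReal.toReal_nonneg
    fun v => ?_)
  have := ENNReal.toReal_mono (by finiteness) (key v)
  simpa using this

/-- Rescaling to finite measures is needed because the pieces of a partition carry arbitrary masses.
-/
theorem IsWeakFDerivAt.hasFDerivAt {K : Θ → Kernel E E}
    {L : (E →ᵇ ℝ) → (E →ᵇ StrongDual ℝ Θ)} {θ : Θ} (h : IsWeakFDerivAt K L θ)
    (m : Measure E) [IsFiniteMeasure m] (f : E →ᵇ ℝ) :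
    HasFDerivAt (fun η => ∫ x', ∫ x, f x ∂K η x' ∂m) (∫ x', L f x' ∂m) θ := by
  rcases eq_zero_or_neZero m with rfl | hm
  · simpa using hasFDerivAt_const (0 : ℝ) θ
  have h1 : m = m Set.univ • ((m Set.univ)⁻¹ • m) := by
    rw [smul_smul, ENNReal.mul_inv_cancel (NeZero.ne _) (measure_ne_top _ _), one_smul]
  rw [h1]
  simp only [integral_smul_measure _ (m Set.univ)]
  have : IsProbabilityMeasure ((m Set.univ)⁻¹ • m) := isProbabilityMeasureSMul
  exact (h ((m Set.univ)⁻¹ • m) f).const_smul (m Set.univ).toReal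

/-- On each piece the derivative is dominated by the integral of `supDensity`, which does not
involve the test function; the pieces therefore add up to one integral over `Ω`, and their number
does not matter. -/
theorem norm_sum_integral_partition_le {Ω : Type*} [MeasurableSpace Ω] {P : Measure Ω}
    {κ : Kernel Ω E} {κ' : Kernel E E}
    {L : (E →ᵇ ℝ) → (E →ᵇ StrongDual ℝ Θ)} {ℓ : E → E → StrongDual ℝ Θ}
    (hℓ : IsDensity L κ' ℓ) (hΛ : AEMeasurable (supDensity ℓ) (κ' ∘ₘ (κ ∘ₘ P))) {C : ℝ}
    (hC : 0 ≤ C) (hbound : ∫⁻ z, supDensity ℓ z ∂(κ' ∘ₘ (κ ∘ₘ P)) ≤ ENNReal.ofReal C)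
    {f : ℕ → E →ᵇ ℝ} (hf : ∀ i x, f i x ∈ Set.Icc (0 : ℝ) 1) {I : Finset ℕ} {A : ℕ → Set Ω}
    (hA : ∀ i, MeasurableSet (A i)) (hAd : Set.PairwiseDisjoint (I : Set ℕ) A)
    (hAu : ⋃ i ∈ I, A i = Set.univ) :
    ‖∑ i ∈ I, ∫ x', L (f i) x' ∂(κ ∘ₘ P.restrict (A i))‖ ≤ C := by
  obtain ⟨Λ', hΛm, hΛle, hΛeq⟩ := exists_measurable_ge_lintegral_eq hΛ
  have hφm : Measurable fun x' => ∫⁻ z, Λ' z ∂κ' x' := hΛm.lintegral_kernel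
  have hT : ∀ i, ‖∫ x', L (f i) x' ∂(κ ∘ₘ P.restrict (A i))‖ₑ ≤
      ∫⁻ ω in A i, ∫⁻ x', ∫⁻ z, Λ' z ∂κ' x' ∂κ ω ∂P := fun i => by
    rw [← Measure.lintegral_bind κ.aemeasurable hφm.aemeasurable]
    refine (enorm_integral_le_lintegral_enorm _).trans (lintegral_mono fun x' => ?_)
    exact (enorm_apply_le_lintegral_supDensity hℓ (hf i) x').trans (lintegral_mono hΛle)
  obtain ⟨T, hTe⟩ : ∃ T : ℕ → StrongDual ℝ Θ,
    ∀ i, ∫ x', L (f i) x' ∂(κ ∘ₘ P.restrict (A i)) = T i := ⟨_, fun _ => rfl⟩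
  simp only [hTe] at hT ⊢
  have h1 : ENNReal.ofReal (∑ i ∈ I, ‖T i‖) ≤ ENNReal.ofReal C := by
    calc _ = ∑ i ∈ I, ‖T i‖ₑ := by
          rw [ENNReal.ofReal_sum_of_nonneg fun i _ => norm_nonneg (T i)]
          exact Finset.sum_congr rfl fun i _ => ofReal_norm (T i)
      _ ≤ ∑ i ∈ I, ∫⁻ ω in A i, ∫⁻ x', ∫⁻ z, Λ' z ∂κ' x' ∂κ ω ∂P :=
          Finset.sum_le_sum fun i _ => hT i
      _ = ∫⁻ ω, ∫⁻ x', ∫⁻ z, Λ' z ∂κ' x' ∂κ ω ∂P := by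
          rw [← lintegral_biUnion_finset hAd fun i _ => hA i, hAu, Measure.restrict_univ]
      _ = ∫⁻ z, Λ' z ∂(κ' ∘ₘ (κ ∘ₘ P)) := by
          rw [Measure.lintegral_bind κ'.aemeasurable hΛm.aemeasurable,
            Measure.lintegral_bind κ.aemeasurable hφm.aemeasurable]
      _ ≤ ENNReal.ofReal C := hΛeq.trans_le hbound
  exact (norm_sum_le I T).trans ((ENNReal.ofReal_le_ofReal_iff hC).1 h1)

/-- Mean value inequality along the segment: only the last transition `K η` varies, while `κ`, the
partition and the test functions stay fixed. -/
theorem abs_sum_integral_partition_sub_le {Ω : Type*} [MeasurableSpace Ω] {P : Measure Ω}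
    [IsFiniteMeasure P] {κ : Kernel Ω E} [IsMarkovKernel κ] {K : Θ → Kernel E E}
    [∀ θ, IsMarkovKernel (K θ)] {L : Θ → (E →ᵇ ℝ) → (E →ᵇ StrongDual ℝ Θ)}
    {ℓ : Θ → E → E → StrongDual ℝ Θ} {α θ : Θ}
    (hL : ∀ η ∈ segment ℝ α θ, IsWeakFDerivAt K (L η) η)
    (hℓ : ∀ η ∈ segment ℝ α θ, IsDensity (L η) (K η) (ℓ η))
    (hΛ : ∀ η ∈ segment ℝ α θ, UniversallyMeasurable (supDensity (ℓ η))) {C : ℝ} (hC : 0 ≤ C)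
    (hbound : ∀ η ∈ segment ℝ α θ,
      ∫⁻ z, supDensity (ℓ η) z ∂(K η ∘ₘ (κ ∘ₘ P)) ≤ ENNReal.ofReal C)
    {f : ℕ → E →ᵇ ℝ} (hf : ∀ i x, f i x ∈ Set.Icc (0 : ℝ) 1) {I : Finset ℕ} {A : ℕ → Set Ω}
    (hA : ∀ i, MeasurableSet (A i)) (hAd : Set.PairwiseDisjoint (I : Set ℕ) A)
    (hAu : ⋃ i ∈ I, A i = Set.univ) :
    |∑ i ∈ I, ∫ x', ∫ x, f i x ∂K θ x' ∂(κ ∘ₘ P.restrict (A i)) -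
      ∑ i ∈ I, ∫ x', ∫ x, f i x ∂K α x' ∂(κ ∘ₘ P.restrict (A i))| ≤ C * ‖θ - α‖ := by
  rw [← Real.norm_eq_abs]
  exact (convex_segment α θ).norm_image_sub_le_of_norm_hasFDerivWithin_le
    (f := fun η => ∑ i ∈ I, ∫ x', ∫ x, f i x ∂K η x' ∂(κ ∘ₘ P.restrict (A i)))
    (f' := fun η => ∑ i ∈ I, ∫ x', L η (f i) x' ∂(κ ∘ₘ P.restrict (A i)))
    (fun η hη => (HasFDerivAt.fun_sum fun i _ =>
      (hL η hη).hasFDerivAt (κ ∘ₘ P.restrict (A i)) (f i)).hasFDerivWithinAt)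
    (fun η hη => norm_sum_integral_partition_le (hℓ η hη) (hΛ η hη _ inferInstance) hC
      (hbound η hη) hf hA hAd hAu) (left_mem_segment ℝ α θ) (right_mem_segment ℝ α θ)

/-- The supremum is the increasing limit of maxima over the first `n + 1` test functions. The level
sets of a measurable argmax `j n` form a partition with one test function per piece, with a bound
independent of `n`. -/
theorem lintegral_iSup_integral_sub_le [BorelSpace E] {Ω : Type*} [MeasurableSpace Ω] {P : Measure Ω}
    [IsFiniteMeasure P] {κ : Kernel Ω E} [IsMarkovKernel κ] {K : Θ → Kernel E E}
    [∀ θ, IsMarkovKernel (K θ)] {L : Θ → (E →ᵇ ℝ) → (E →ᵇ StrongDual ℝ Θ)}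
    {ℓ : Θ → E → E → StrongDual ℝ Θ} {α θ : Θ}
    (hL : ∀ η ∈ segment ℝ α θ, IsWeakFDerivAt K (L η) η)
    (hℓ : ∀ η ∈ segment ℝ α θ, IsDensity (L η) (K η) (ℓ η))
    (hΛ : ∀ η ∈ segment ℝ α θ, UniversallyMeasurable (supDensity (ℓ η))) {C : ℝ} (hC : 0 ≤ C)
    (hbound : ∀ η ∈ segment ℝ α θ,
      ∫⁻ z, supDensity (ℓ η) z ∂(K η ∘ₘ (κ ∘ₘ P)) ≤ ENNReal.ofReal C)
    {f : ℕ → E →ᵇ ℝ} (hf0 : f 0 = 0) (hf : ∀ i x, f i x ∈ Set.Icc (0 : ℝ) 1) :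
    ∫⁻ ω, ⨆ i, ENNReal.ofReal (∫ x, f i x ∂(K θ ∘ₘ κ ω) - ∫ x, f i x ∂(K α ∘ₘ κ ω)) ∂P ≤
      ENNReal.ofReal (C * ‖θ - α‖) := by
  have hfm : ∀ i, Measurable (f i) := fun i => (f i).continuous.measurable
  set ψ : ℕ → Θ → E → ℝ := fun i η x' => ∫ x, f i x ∂K η x'
  have hψm : ∀ i η, Measurable (ψ i η) := fun i η => measurable_integral_kernel (hfm i)
  have hψ1 : ∀ i η x, ψ i η x ∈ Set.Icc (0 : ℝ) 1 := fun i η x => integral_mem_Icc (hfm i) (hf i)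
  have hψi : ∀ i η (m : Measure E) [IsFiniteMeasure m], Integrable (ψ i η) m := fun i η m _ =>
    integrable_of_bounded (hψm i η) (hψ1 i η)
  set u : ℕ → Ω → ℝ := fun i ω => ∫ x', ψ i θ x' ∂κ ω - ∫ x', ψ i α x' ∂κ ω
  have hum : ∀ i, Measurable (u i) := fun i =>
    (measurable_integral_kernel (hψm i θ)).sub (measurable_integral_kernel (hψm i α))
  have hub : ∀ i ω, u i ω ∈ Set.Icc (-1 : ℝ) 1 := fun i ω => by
    have h1 := integral_mem_Icc (m := κ ω) (hψm i θ) (hψ1 i θ)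
    have h2 := integral_mem_Icc (m := κ ω) (hψm i α) (hψ1 i α)
    exact ⟨by linarith [h1.1, h2.2], by linarith [h1.2, h2.1]⟩
  have hu : ∀ i ω, ∫ x, f i x ∂(K θ ∘ₘ κ ω) - ∫ x, f i x ∂(K α ∘ₘ κ ω) = u i ω := fun i ω => by
    rw [integral_comp_measure (integrable_of_bounded (hfm i) (hf i)),
      integral_comp_measure (integrable_of_bounded (hfm i) (hf i))]
  simp_rw [hu]
  -- Since index `0` competes in the maximum, the maximal difference is nonnegative and
  -- `ENNReal.ofReal` loses nothing.
  have hu0 : ∀ ω, u 0 ω = 0 := fun ω => by simp [u, ψ, hf0]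
  choose j hj hjn hmax using exists_measurable_argmax hum
  have hjm : ∀ n, Measurable fun ω => u (j n ω) ω := fun n => by
    have : Measurable fun q : ℕ × Ω => u q.1 q.2 := measurable_from_prod_countable_right hum
    exact this.comp ((hj n).prodMk measurable_id)
  have hsup : ∀ ω, ⨆ i, ENNReal.ofReal (u i ω) = ⨆ n, ENNReal.ofReal (u (j n ω) ω) := fun ω =>
    le_antisymm (iSup_le fun i => le_iSup_of_le i (ENNReal.ofReal_le_ofReal (hmax i ω i le_rfl)))
      (iSup_le fun n => le_iSup (fun i => ENNReal.ofReal (u i ω)) (j n ω))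
  simp_rw [hsup]
  have hem : ∀ n, Measurable fun ω => ENNReal.ofReal (u (j n ω) ω) := fun n =>
    ENNReal.measurable_ofReal.comp (hjm n)
  rw [lintegral_iSup hem fun n n' hn ω =>
    ENNReal.ofReal_le_ofReal (hmax n' ω _ ((hjn n ω).trans hn))]
  refine iSup_le fun n => ?_
  set A : ℕ → Set Ω := fun i => j n ⁻¹' {i}
  have hA : ∀ i, MeasurableSet (A i) := fun i => hj n (measurableSet_singleton i)
  have hAd : Set.PairwiseDisjoint ((Finset.range (n + 1) : Finset ℕ) : Set ℕ) A :=
    fun i _ i' _ hii => Set.disjoint_left.2 fun ω h1 h2 => hii (h1.symm.trans h2)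
  have hAu : ⋃ i ∈ Finset.range (n + 1), A i = Set.univ := Set.eq_univ_of_forall fun ω =>
    Set.mem_biUnion (Finset.mem_coe.2 (Finset.mem_range.2 (Nat.lt_succ_of_le (hjn n ω)))) rfl
  set M : ℕ → Measure E := fun i => κ ∘ₘ P.restrict (A i)
  have hnn : ∀ ω, 0 ≤ u (j n ω) ω := fun ω => (hu0 ω).ge.trans (hmax n ω 0 n.zero_le)
  have hint : Integrable (fun ω => u (j n ω) ω) P := integrable_of_bounded (hjm n) fun ω => hub _ ω
  rw [← ofReal_integral_eq_lintegral_ofReal hint (ae_of_all _ hnn)]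
  refine ENNReal.ofReal_le_ofReal ?_
  set D : Θ → ℝ := fun η => ∑ i ∈ Finset.range (n + 1), ∫ x', ψ i η x' ∂M i
  have hD : ∫ ω, u (j n ω) ω ∂P = D θ - D α := by
    rw [← setIntegral_univ, ← hAu, integral_biUnion_finset _ (fun i _ => hA i) hAd
      fun i _ => hint.integrableOn, ← Finset.sum_sub_distrib]
    refine Finset.sum_congr rfl fun i _ => ?_
    rw [integral_comp_measure (hψi i θ _), integral_comp_measure (hψi i α _)]
    have hi : ∀ η, Integrable (fun ω => ∫ x', ψ i η x' ∂κ ω) (P.restrict (A i)) := fun η =>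
      integrable_of_bounded (measurable_integral_kernel (hψm i η)) fun ω =>
        integral_mem_Icc (hψm i η) (hψ1 i η)
    rw [← integral_sub (hi θ) (hi α)]
    refine setIntegral_congr_fun (hA i) fun ω hω => ?_
    have : j n ω = i := hω
    simp only [this, u]
  rw [hD]
  refine (le_abs_self _).trans ?_
  exact abs_sum_integral_partition_sub_le hL hℓ hΛ hC hbound hf hA hAd hAu

end Derivative

/-! ### Expectations under the law of the signal and the observations -/

section Noise

variable {p : ℕ} {σ : ℝ}

/-- The Gaussian density of standard deviation `2 * σ` absorbs the factor exponential in `‖v‖`. -/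
theorem lintegral_likelihoodRatioBound_lt_top (hσ : 0 < σ) (H : ℝ) :
    ∫⁻ v, ENNReal.ofReal (Real.exp (2 * H * (‖v‖ + 2 * H) / σ ^ 2)) ∂gaussNoise p σ < ∞ := by
  have hσ2 : 0 < 2 * σ := by positivity
  have := isProbabilityMeasure_gaussNoise p hσ2
  have hm : ∀ s : ℝ, Measurable fun v : EuclideanSpace ℝ (Fin p) =>
      ENNReal.ofReal (gaussDensity s v) := fun s =>
    ENNReal.measurable_ofReal.comp continuous_gaussDensity.measurable
  have hm2 : Measurable fun v : EuclideanSpace ℝ (Fin p) =>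
      ENNReal.ofReal (Real.exp (2 * H * (‖v‖ + 2 * H) / σ ^ 2)) := by fun_prop
  set q : ℝ := (2 * Real.pi * (2 * σ) ^ 2) ^ (-(p : ℝ) / 2) with hq
  set q' : ℝ := (2 * Real.pi * σ ^ 2) ^ (-(p : ℝ) / 2) with hq'
  have hq0 : 0 < q := by positivity
  have hq0' : 0 < q' := by positivity
  set C : ℝ := q' / q * Real.exp (8 * H ^ 2 / σ ^ 2)
  have key : ∀ v : EuclideanSpace ℝ (Fin p),
      gaussDensity σ v * Real.exp (2 * H * (‖v‖ + 2 * H) / σ ^ 2) ≤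
        C * gaussDensity (2 * σ) v := fun v => by
    have e : C * gaussDensity (2 * σ) v =
        q' * Real.exp (8 * H ^ 2 / σ ^ 2 + -‖v‖ ^ 2 / (2 * (2 * σ) ^ 2)) := by
      simp only [C, gaussDensity, ← hq, Real.exp_add]
      field_simp
    rw [e, gaussDensity, ← hq', mul_assoc, ← Real.exp_add]
    refine mul_le_mul_of_nonneg_left (Real.exp_le_exp.2 ?_) hq0'.le
    have h1 : -‖v‖ ^ 2 / (2 * σ ^ 2) + 2 * H * (‖v‖ + 2 * H) / σ ^ 2 =
        (-4 * ‖v‖ ^ 2 + 16 * H * (‖v‖ + 2 * H)) / (8 * σ ^ 2) := by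
      field_simp
      ring
    have h2 : 8 * H ^ 2 / σ ^ 2 + -‖v‖ ^ 2 / (2 * (2 * σ) ^ 2) =
        (64 * H ^ 2 - ‖v‖ ^ 2) / (8 * σ ^ 2) := by
      field_simp
      ring
    rw [h1, h2]
    gcongr
    -- What remains is `3‖v‖² - 16H‖v‖ + 32H² ≥ 0`; three times the left side is `(3‖v‖ - 8H)² +
    -- 32H²`.
    nlinarith [sq_nonneg (3 * ‖v‖ - 8 * H), sq_nonneg H]
  rw [gaussNoise, lintegral_withDensity_eq_lintegral_mul _ (hm σ) hm2]
  calc _ ≤ ∫⁻ v : EuclideanSpace ℝ (Fin p), ENNReal.ofReal C *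
        ENNReal.ofReal (gaussDensity (2 * σ) v) := by
        refine lintegral_mono fun v => ?_
        rw [Pi.mul_apply, ← ENNReal.ofReal_mul (gaussDensity_pos hσ v).le,
          ← ENNReal.ofReal_mul (by positivity)]
        exact ENNReal.ofReal_le_ofReal (key v)
    _ = ENNReal.ofReal C * gaussNoise p (2 * σ) Set.univ := by
        rw [lintegral_const_mul _ (hm _), gaussNoise, withDensity_apply _ MeasurableSet.univ,
          Measure.restrict_univ]
    _ < ∞ := by
        rw [measure_univ, mul_one]
        exact ENNReal.ofReal_lt_top

variable {E : Type*} [MeasurableSpace E] {h : E → EuclideanSpace ℝ (Fin p)}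
  {μ : Measure E} [IsProbabilityMeasure μ] {κ : Kernel E E} [IsMarkovKernel κ]

/-- As `h` is bounded, each factor is dominated by a function of the noise alone, and independence
factorises the expectation whatever the law of the signal. -/
theorem lintegral_prod_likelihoodRatioBound_le (hσ : 0 < σ) {H : ℝ}
    (hH : ∀ x, ‖h x‖ ≤ H) (s : Finset ℕ) :
    ∫⁻ ω, ∏ k ∈ s, ENNReal.ofReal (likelihoodRatioBound σ H (ω.2 k)) ∂pairLaw h hσ μ κ ≤
      (∫⁻ v, ENNReal.ofReal (Real.exp (2 * H * (‖v‖ + 2 * H) / σ ^ 2)) ∂gaussNoise p σ) ^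
        s.card := by
  have := isProbabilityMeasure_gaussNoise p hσ
  obtain ⟨x0⟩ := Measure.nonempty_of_neZero μ
  have hH0 : 0 ≤ H := (norm_nonneg _).trans (hH x0)
  set c : EuclideanSpace ℝ (Fin p) → ℝ≥0∞ := fun v =>
    ENNReal.ofReal (Real.exp (2 * H * (‖v‖ + 2 * H) / σ ^ 2))
  have hc : Measurable c := by fun_prop
  have hind := iIndepFun_infinitePi (P := fun _ : ℕ => gaussNoise p σ) (X := fun _ => c)
    fun _ => hc
  rw [pairLaw]
  refine (lintegral_map_le _ _).trans ?_
  calc _ ≤ ∫⁻ ω : (ℕ → E) × (ℕ → EuclideanSpace ℝ (Fin p)), ∏ k ∈ s, c (ω.2 k)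
        ∂(chainLaw μ κ).prod (Measure.infinitePi fun _ : ℕ => gaussNoise p σ) := by
        refine lintegral_mono fun ω => Finset.prod_le_prod' fun k _ => ?_
        refine ENNReal.ofReal_le_ofReal (Real.exp_le_exp.2 ?_)
        have : ‖h (ω.1 k) + ω.2 k‖ ≤ ‖ω.2 k‖ + H :=
          (norm_add_le _ _).trans (by linarith [hH (ω.1 k)])
        exact div_le_div_of_nonneg_right (mul_le_mul_of_nonneg_left
          (by dsimp only; linarith) (by positivity)) (by positivity)
    _ = ∫⁻ v : ℕ → EuclideanSpace ℝ (Fin p), ∏ k ∈ s, c (v k)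
        ∂(Measure.infinitePi fun _ : ℕ => gaussNoise p σ) := by
        rw [lintegral_prod _ (by fun_prop)]
        simp
    _ = ∏ k ∈ s, ∫⁻ v : ℕ → EuclideanSpace ℝ (Fin p), c (v k)
        ∂(Measure.infinitePi fun _ : ℕ => gaussNoise p σ) :=
        lintegral_prod_eq_prod_lintegral_of_indepFun s _ hind fun k =>
          hc.comp (measurable_pi_apply k)
    _ = _ := by
        rw [Finset.prod_eq_pow_card]
        intro k _
        rw [← lintegral_map hc (measurable_pi_apply k)]
        rw [show Measure.map (fun a => a k) (Measure.infinitePi fun _ : ℕ => gaussNoise p σ) = _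
          from Measure.infinitePi_map_eval _ k]

end Noise

/-! ### The filter averaged over the observations -/

section Expectation

variable {E : Type*} [MeasurableSpace E] {p : ℕ} {σ : ℝ} {h : E → EuclideanSpace ℝ (Fin p)}

/-- The optimal filter as a Markov kernel from the space of the paths of the signal and the
observations. -/
noncomputable def filterKernel (hh : Measurable h) (σ : ℝ) (μ : Measure E)
    [IsProbabilityMeasure μ] (κ : Kernel E E) [IsMarkovKernel κ] (n : ℕ) : Kernel ((ℕ → E) × (ℕ → EuclideanSpace ℝ (Fin p))) E where
  toFun ω := optimalFilter h σ μ κ n ω.2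
  measurable' := (measurable_optimalFilter hh n).comp measurable_snd

theorem isMarkovKernel_filterKernel (hh : Measurable h) (hσ : 0 < σ) (μ : Measure E)
    [IsProbabilityMeasure μ] (κ : Kernel E E) [IsMarkovKernel κ] (n : ℕ) :
    IsMarkovKernel (filterKernel hh σ μ κ n) :=
  ⟨fun ω => isProbabilityMeasure_optimalFilter (y := ω.2) hσ hh n⟩

theorem bind_mono_measure {m m' : Measure E} (hm : m ≤ m') (κ : Kernel E E) :
    κ ∘ₘ m ≤ κ ∘ₘ m' := by
  refine Measure.le_iff.2 fun A hA => ?_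
  rw [Measure.bind_apply hA κ.aemeasurable, Measure.bind_apply hA κ.aemeasurable]
  exact lintegral_mono' hm le_rfl

/-- The law of the signal and the observations, weighted by the likelihood ratio bound of the
observation at time `n`. -/
noncomputable def weightedPairLaw (h : E → EuclideanSpace ℝ (Fin p)) (H : ℝ) (hσ : 0 < σ)
    (μ : Measure E) (κ : Kernel E E) [IsMarkovKernel κ] (n : ℕ) :
    Measure ((ℕ → E) × (ℕ → EuclideanSpace ℝ (Fin p))) :=
  (pairLaw h hσ μ κ).withDensity fun ω => ENNReal.ofReal (likelihoodRatioBound σ H (ω.2 n))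

theorem measurable_likelihoodRatioBound_eval (H : ℝ) (n : ℕ) :
    Measurable fun ω : (ℕ → E) × (ℕ → EuclideanSpace ℝ (Fin p)) =>
      ENNReal.ofReal (likelihoodRatioBound σ H (ω.2 n)) :=
  ENNReal.measurable_ofReal.comp ((continuous_likelihoodRatioBound H).measurable.comp
    (by fun_prop))

variable {μ μ' : Measure E} [IsProbabilityMeasure μ] [IsProbabilityMeasure μ']
  {κ κ' : Kernel E E} [IsMarkovKernel κ] [IsMarkovKernel κ']

theorem weightedPairLaw_univ_le (hσ : 0 < σ) {H : ℝ}
    (hH : ∀ x, ‖h x‖ ≤ H) (n : ℕ) :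
    weightedPairLaw h H hσ μ κ n Set.univ ≤
      ∫⁻ v, ENNReal.ofReal (Real.exp (2 * H * (‖v‖ + 2 * H) / σ ^ 2)) ∂gaussNoise p σ := by
  rw [weightedPairLaw, withDensity_apply _ MeasurableSet.univ, Measure.restrict_univ]
  simpa using lintegral_prod_likelihoodRatioBound_le (μ := μ) (κ := κ) hσ hH {n}

/-- `optimalFilter_le` supplies `n` factors and the weight at time `n + 1` one more. The
observations may come from another model, `μ'` and `κ'`, than the one of the filter. -/
theorem filterKernel_comp_weightedPairLaw_le (hh : Measurable h) (hσ : 0 < σ) {H : ℝ}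
    (hH : ∀ x, ‖h x‖ ≤ H) (n : ℕ) :
    filterKernel hh σ μ κ n ∘ₘ weightedPairLaw h H hσ μ' κ' (n + 1) ≤
      (∫⁻ v, ENNReal.ofReal (Real.exp (2 * H * (‖v‖ + 2 * H) / σ ^ 2)) ∂gaussNoise p σ) ^ (n + 1) •
        (chainLaw μ κ).map fun x => x n := by
  refine Measure.le_iff.2 fun A hA => ?_
  rw [Measure.bind_apply hA (filterKernel hh σ μ κ n).aemeasurable, weightedPairLaw,
    lintegral_withDensity_eq_lintegral_mul _ (measurable_likelihoodRatioBound_eval H (n + 1))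
      ((filterKernel hh σ μ κ n).measurable_coe hA), Measure.smul_apply, smul_eq_mul]
  have h1 := lintegral_prod_likelihoodRatioBound_le (μ := μ') (κ := κ') hσ hH
    (Finset.Icc 1 (n + 1))
  rw [Nat.card_Icc, Nat.add_sub_cancel] at h1
  refine le_trans ?_ (mul_le_mul' h1 le_rfl)
  rw [← lintegral_mul_const _
    (Finset.measurable_prod _ fun k _ => measurable_likelihoodRatioBound_eval H k)]
  refine lintegral_mono fun ω => ?_
  have h2 := Measure.le_iff.1 (optimalFilter_le (μ := μ) (κ := κ) (y := ω.2) hσ hh hH n) A hA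
  rw [Measure.smul_apply, smul_eq_mul, ENNReal.ofReal_prod_of_nonneg
    fun k _ => show 0 ≤ likelihoodRatioBound σ H (ω.2 k) from (Real.exp_pos _).le] at h2
  rw [Finset.prod_Icc_succ_top (by omega), Pi.mul_apply, mul_comm (∏ k ∈ _, _), mul_assoc]
  exact mul_le_mul' le_rfl h2

/-- A substitute for Hölder's inequality: either `t ≤ M`, or `(t / M) ^ n ≥ 1`. -/
theorem le_add_pow_succ_mul {M : ℝ≥0∞} (hM0 : M ≠ 0) (hM : M ≠ ∞) (t : ℝ≥0∞) (n : ℕ) :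
    t ≤ M + M⁻¹ ^ n * t ^ (n + 1) := by
  rcases le_total t M with h | h
  · exact h.trans le_self_add
  · refine le_trans ?_ le_add_self
    have h1 : 1 ≤ M⁻¹ * t := by
      rw [← ENNReal.inv_mul_cancel hM0 hM]
      exact mul_le_mul' le_rfl h
    calc t = 1 * t := (one_mul t).symm
      _ ≤ (M⁻¹ * t) ^ n * t := mul_le_mul' (one_le_pow₀ h1) le_rfl
      _ = _ := by rw [mul_pow, pow_succ, mul_assoc]

theorem lintegral_comp_filterKernel_le (hh : Measurable h) (hσ : 0 < σ) {H : ℝ}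
    (hH : ∀ x, ‖h x‖ ≤ H) (n : ℕ) {κ'' : Kernel E E} [IsMarkovKernel κ''] {u : E → ℝ≥0∞}
    (hu : UniversallyMeasurable u) {C₀ C₁ : ℝ≥0∞} (hC₀ : C₀ ≠ ∞) (hC₁ : C₁ ≠ ∞)
    (hC : ∫⁻ v, ENNReal.ofReal (Real.exp (2 * H * (‖v‖ + 2 * H) / σ ^ 2)) ∂gaussNoise p σ ≤ C₁)
    (hbound : ∫⁻ x, ∫⁻ z, u z ^ (n + 2) ∂κ'' (x n) ∂chainLaw μ κ ≤ C₀ ^ (n + 2)) :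
    ∫⁻ z, u z ∂(κ'' ∘ₘ (filterKernel hh σ μ κ n ∘ₘ weightedPairLaw h H hσ μ' κ' (n + 1))) ≤
      (C₁ * C₀ + 1) * C₁ + C₀ := by
  set Q := κ'' ∘ₘ (filterKernel hh σ μ κ n ∘ₘ weightedPairLaw h H hσ μ' κ' (n + 1)) with hQ
  -- The threshold exceeds `C₁ * C₀`, so that the power `(M⁻¹ * (C₁ * C₀)) ^ (n + 1)` stays below
  -- one for all `n`; adding `1` keeps `M` nonzero.
  set M := C₁ * C₀ + 1
  have hM0 : M ≠ 0 := by simp [M]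
  have hM : M ≠ ∞ := by finiteness
  have := isMarkovKernel_filterKernel hh hσ μ κ n
  have hQu : Q Set.univ ≤ C₁ := by
    rw [hQ, Measure.comp_apply_univ, Measure.comp_apply_univ]
    exact (weightedPairLaw_univ_le hσ hH _).trans hC
  have hQle : Q ≤ C₁ ^ (n + 1) • (κ'' ∘ₘ (chainLaw μ κ).map fun x => x n) := by
    rw [← Measure.bind_smul]
    refine bind_mono_measure ((filterKernel_comp_weightedPairLaw_le hh hσ hH n).trans ?_) _
    exact Measure.le_iff.2 fun A _ => by
      simp only [Measure.smul_apply, smul_eq_mul]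
      gcongr
  have hprob : IsProbabilityMeasure ((chainLaw μ κ).map fun x => x n) :=
    Measure.isProbabilityMeasure_map (measurable_pi_apply n).aemeasurable
  have hum : AEMeasurable (fun z => u z ^ (n + 2))
      (κ'' ∘ₘ (chainLaw μ κ).map fun x => x n) := (hu _ inferInstance).pow_const _
  have hQp : ∫⁻ z, u z ^ (n + 2) ∂Q ≤ C₁ ^ (n + 1) * C₀ ^ (n + 2) := by
    refine (lintegral_mono' hQle le_rfl).trans ?_
    rw [lintegral_smul_measure, smul_eq_mul]
    refine mul_le_mul' le_rfl (le_trans (le_of_eq ?_) hbound)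
    have hum' : AEMeasurable (fun x => ∫⁻ z, u z ^ (n + 2) ∂κ'' x)
        ((chainLaw μ κ).map fun x => x n) :=
      (Measure.aemeasurable_lintegral hum).comp_aemeasurable κ''.aemeasurable
    rw [Measure.lintegral_bind κ''.aemeasurable hum,
      lintegral_map' hum' (measurable_pi_apply n).aemeasurable]
  calc ∫⁻ z, u z ∂Q ≤ ∫⁻ z, (M + M⁻¹ ^ (n + 1) * u z ^ (n + 2)) ∂Q :=
        lintegral_mono fun z => le_add_pow_succ_mul hM0 hM _ _
    _ = M * Q Set.univ + M⁻¹ ^ (n + 1) * ∫⁻ z, u z ^ (n + 2) ∂Q := by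
        rw [lintegral_add_left measurable_const, lintegral_const,
          lintegral_const_mul' _ _ (ENNReal.pow_ne_top (ENNReal.inv_ne_top.2 hM0))]
    _ ≤ M * C₁ + M⁻¹ ^ (n + 1) * (C₁ ^ (n + 1) * C₀ ^ (n + 2)) := by gcongr
    _ = M * C₁ + (M⁻¹ * (C₁ * C₀)) ^ (n + 1) * C₀ := by
        rw [mul_pow, mul_pow, pow_succ C₀ (n + 1)]
        ring
    _ ≤ M * C₁ + 1 * C₀ := by
        gcongr
        refine pow_le_one₀ zero_le ?_
        rw [← ENNReal.inv_mul_cancel hM0 hM]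
        exact mul_le_mul' le_rfl le_self_add
    _ = _ := by rw [one_mul]

end Expectation

/-! ### The error of the filter with a wrong parameter -/

section FilterError

theorem sum_range_pow_sub_le {ε : ℝ} (hε : 0 < ε) (hε1 : ε ≤ 1) (n : ℕ) :
    ∑ k ∈ Finset.range n, (1 - ε ^ 2) ^ (n - 1 - k) ≤ 1 / ε ^ 2 := by
  rw [Finset.sum_range_reflect (fun k => (1 - ε ^ 2) ^ k) n, le_div_iff₀ (by positivity)]
  have h1 := geom_sum_mul_neg (1 - ε ^ 2) n
  rw [sub_sub_cancel] at h1
  rw [h1]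
  have : 0 ≤ 1 - ε ^ 2 := sub_nonneg.2 (pow_le_one₀ hε.le hε1)
  linarith [pow_nonneg this n]

variable {E : Type*} [MeasurableSpace E] {p : ℕ} {σ : ℝ} {h : E → EuclideanSpace ℝ (Fin p)}
  {μ μ' : Measure E} [IsProbabilityMeasure μ] [IsProbabilityMeasure μ']
  {κ κ' : Kernel E E} [IsMarkovKernel κ] [IsMarkovKernel κ']

theorem isFilterSequence_optimalFilter (hσ : 0 < σ) (hh : Measurable h)
    (y : ℕ → EuclideanSpace ℝ (Fin p)) :
    IsFilterSequence κ (fun k x => gaussDensity σ (y k - h x))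
      fun n => optimalFilter h σ μ κ n y := by
  intro n
  have h0 := unnormalizedFilter_univ_ne_zero (μ := μ) (κ := κ) (y := y) hσ hh
  have ht := unnormalizedFilter_univ_ne_top (μ := μ) (κ := κ) (y := y) hσ hh
  refine ⟨(unnormalizedFilter h σ μ κ (n + 1) y Set.univ)⁻¹ *
    unnormalizedFilter h σ μ κ n y Set.univ,
    mul_ne_zero (ENNReal.inv_ne_zero.2 (ht _)) (h0 _),
    ENNReal.mul_ne_top (ENNReal.inv_ne_top.2 (h0 _)) (ht _), ?_⟩
  dsimp only
  rw [optimalFilter, optimalFilter, Measure.bind_smul, withDensity_smul_measure, smul_smul,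
    mul_assoc, ENNReal.mul_inv_cancel (h0 _) (ht _), mul_one, ← unnormalizedFilter_succ hσ hh]

variable [TopologicalSpace E] [BorelSpace E]

theorem tvDist_optimalFilter_le (hσ : 0 < σ) (hh : Measurable h) {H : ℝ}
    (hH : ∀ x, ‖h x‖ ≤ H) {ε : ℝ} {lam : Measure E} [IsFiniteMeasure lam] (hε : 0 < ε)
    (hε1 : ε ≤ 1)
    (hmix : ∀ (x : E) (A : Set E), MeasurableSet A →
      ENNReal.ofReal ε * lam A ≤ κ x A ∧ κ x A ≤ ENNReal.ofReal (1 / ε) * lam A)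
    {f : ℕ → E →ᵇ ℝ} (hf : ∀ i x, f i x ∈ Set.Icc (0 : ℝ) 1)
    (hftest : ∀ (m m' : Measure E) [IsFiniteMeasure m] [IsFiniteMeasure m'] (d : ℝ),
        (∀ i, ∫ x, f i x ∂m ≤ ∫ x, f i x ∂m' + d) →
          ∀ A, MeasurableSet A → m.real A ≤ m'.real A + d)
    (y : ℕ → EuclideanSpace ℝ (Fin p)) (n : ℕ) :
    tvDist (optimalFilter h σ μ κ' n y) (optimalFilter h σ μ κ n y) ≤
      2 * ∑ k ∈ Finset.range n, ENNReal.ofReal (2 / ε ^ 2 * (1 - ε ^ 2) ^ (n - 1 - k)) *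
        (ENNReal.ofReal (likelihoodRatioBound σ H (y (k + 1))) *
          ⨆ i, ENNReal.ofReal (∫ x, f i x ∂(κ' ∘ₘ optimalFilter h σ μ κ' k y) -
            ∫ x, f i x ∂(κ ∘ₘ optimalFilter h σ μ κ' k y))) := by
  have hprob := fun n => isProbabilityMeasure_optimalFilter (μ := μ) (κ := κ) (y := y) hσ hh n
  have hprob' := fun n => isProbabilityMeasure_optimalFilter (μ := μ) (κ := κ') (y := y) hσ hh n
  set D : ℕ → ℝ≥0∞ := fun k =>
    ⨆ i, ENNReal.ofReal (∫ x, f i x ∂(κ' ∘ₘ optimalFilter h σ μ κ' k y) -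
      ∫ x, f i x ∂(κ ∘ₘ optimalFilter h σ μ κ' k y))
  have hfm : ∀ i, Measurable (f i) := fun i => (f i).continuous.measurable
  -- The test functions take values in `[0, 1]`, so the local errors are at most `1` and can serve
  -- as real constants in `abs_integral_filter_sub_le`.
  have hD : ∀ k, D k ≠ ∞ := fun k => by
    refine ne_top_of_le_ne_top ENNReal.one_ne_top (iSup_le fun i => ENNReal.ofReal_le_one.2 ?_)
    linarith [(integral_mem_Icc (m := κ' ∘ₘ optimalFilter h σ μ κ' k y) (hfm i) (hf i)).2,
      (integral_mem_Icc (m := κ ∘ₘ optimalFilter h σ μ κ' k y) (hfm i) (hf i)).1]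
  have hd : ∀ k A, MeasurableSet A → (κ' ∘ₘ optimalFilter h σ μ κ' k y).real A ≤
      (κ ∘ₘ optimalFilter h σ μ κ' k y).real A + (D k).toReal := fun k =>
    hftest _ _ _ fun i => by
      have := (ENNReal.ofReal_le_iff_le_toReal (hD k)).1 (le_iSup (fun i =>
        ENNReal.ofReal (∫ x, f i x ∂(κ' ∘ₘ optimalFilter h σ μ κ' k y) -
          ∫ x, f i x ∂(κ ∘ₘ optimalFilter h σ μ κ' k y))) i)
      linarith
  have h0 : optimalFilter h σ μ κ' 0 y = optimalFilter h σ μ κ 0 y := by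
    simp only [optimalFilter, unnormalizedFilter_zero]
  have hr : 0 ≤ 1 - ε ^ 2 := sub_nonneg.2 (pow_le_one₀ hε.le hε1)
  have hc : ∀ k, 0 ≤ likelihoodRatioBound σ H (y k) := fun k => (Real.exp_pos _).le
  have key := fun A (hA : MeasurableSet A) => abs_integral_filter_sub_le
    (c := fun k => likelihoodRatioBound σ H (y k)) (f := A.indicator 1) hε hε1 hmix
    (fun k => continuous_gaussDensity.measurable.comp (by fun_prop))
    (fun k x => gaussDensity_pos hσ _) (fun k x => gaussDensity_le hσ _) hc
    (fun k x x' => gaussDensity_le_mul hσ (hH _) (hH _) _)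
    (isFilterSequence_optimalFilter (μ := μ) (κ := κ) hσ hh y)
    (isFilterSequence_optimalFilter (μ := μ) (κ := κ') hσ hh y) h0 hd
    (measurable_one.indicator hA)
    (fun x => ⟨Set.indicator_nonneg (fun _ _ => zero_le_one) x,
      Set.indicator_le_self' (fun _ _ => zero_le_one) x⟩) n
  set S := ∑ k ∈ Finset.range n, 2 / ε ^ 2 * (1 - ε ^ 2) ^ (n - 1 - k) *
    (likelihoodRatioBound σ H (y (k + 1)) * (D k).toReal)
  have hSe : ∑ k ∈ Finset.range n, ENNReal.ofReal (2 / ε ^ 2 * (1 - ε ^ 2) ^ (n - 1 - k)) *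
      (ENNReal.ofReal (likelihoodRatioBound σ H (y (k + 1))) * D k) = ENNReal.ofReal S := by
    rw [ENNReal.ofReal_sum_of_nonneg fun k _ => mul_nonneg
      (mul_nonneg (by positivity) (pow_nonneg hr _)) (mul_nonneg (hc _) ENNReal.toReal_nonneg)]
    refine Finset.sum_congr rfl fun k _ => ?_
    rw [ENNReal.ofReal_mul (mul_nonneg (by positivity) (pow_nonneg hr _)),
      ENNReal.ofReal_mul (hc _), ENNReal.ofReal_toReal (hD k)]
  rw [hSe]
  have hreal : ∀ (m m' : Measure E) [IsFiniteMeasure m] [IsFiniteMeasure m'] (A : Set E),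
      m.real A ≤ m'.real A + S → m A ≤ m' A + ENNReal.ofReal S := fun m m' _ _ A hle => by
    rw [← ofReal_measureReal (μ := m), ← ofReal_measureReal (μ := m')]
    exact (ENNReal.ofReal_le_ofReal hle).trans ENNReal.ofReal_add_le
  refine tvDist_le (fun A hA => hreal _ _ A ?_) fun A hA => hreal _ _ A ?_
  all_goals
    have := abs_le.1 (key A hA)
    rw [integral_indicator_one hA, integral_indicator_one hA] at this
    linarith

omit [IsMarkovKernel κ] in
theorem measurable_predictionError (hh : Measurable h) (f : ℕ → E →ᵇ ℝ) (k : ℕ) :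
    Measurable fun ω : (ℕ → E) × (ℕ → EuclideanSpace ℝ (Fin p)) =>
      ⨆ i, ENNReal.ofReal (∫ x, f i x ∂(κ' ∘ₘ optimalFilter h σ μ κ' k ω.2) -
        ∫ x, f i x ∂(κ ∘ₘ optimalFilter h σ μ κ' k ω.2)) := by
  have hm : ∀ (η : Kernel E E) i, Measurable fun ω : (ℕ → E) × (ℕ → EuclideanSpace ℝ (Fin p)) =>
      ∫ x, f i x ∂(η ∘ₘ optimalFilter h σ μ κ' k ω.2) := by
    intro η i
    have := measurable_integral_kernel (κ := η ∘ₖ filterKernel hh σ μ κ' k)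
      (f i).continuous.measurable
    simp only [Kernel.comp_apply] at this
    exact this
  exact Measurable.iSup fun i => ENNReal.measurable_ofReal.comp ((hm κ' i).sub (hm κ i))

theorem lintegral_tvDist_optimalFilter_le (hσ : 0 < σ) (hh : Measurable h) {H : ℝ}
    (hH : ∀ x, ‖h x‖ ≤ H) {ε : ℝ} {lam : Measure E} [IsFiniteMeasure lam] (hε : 0 < ε)
    (hε1 : ε ≤ 1)
    (hmix : ∀ (x : E) (A : Set E), MeasurableSet A →
      ENNReal.ofReal ε * lam A ≤ κ x A ∧ κ x A ≤ ENNReal.ofReal (1 / ε) * lam A)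
    {f : ℕ → E →ᵇ ℝ} (hf : ∀ i x, f i x ∈ Set.Icc (0 : ℝ) 1)
    (hftest : ∀ (m m' : Measure E) [IsFiniteMeasure m] [IsFiniteMeasure m'] (d : ℝ),
        (∀ i, ∫ x, f i x ∂m ≤ ∫ x, f i x ∂m' + d) →
          ∀ A, MeasurableSet A → m.real A ≤ m'.real A + d)
    {P : Measure ((ℕ → E) × (ℕ → EuclideanSpace ℝ (Fin p)))} {B : ℝ≥0∞}
    (hB : ∀ k, ∫⁻ ω, ENNReal.ofReal (likelihoodRatioBound σ H (ω.2 (k + 1))) *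
      ⨆ i, ENNReal.ofReal (∫ x, f i x ∂(κ' ∘ₘ optimalFilter h σ μ κ' k ω.2) -
        ∫ x, f i x ∂(κ ∘ₘ optimalFilter h σ μ κ' k ω.2)) ∂P ≤ B) (n : ℕ) :
    ∫⁻ ω, tvDist (optimalFilter h σ μ κ' n ω.2) (optimalFilter h σ μ κ n ω.2) ∂P ≤
      2 * (ENNReal.ofReal (2 / ε ^ 2 * (1 / ε ^ 2)) * B) := by
  have hr : 0 ≤ 1 - ε ^ 2 := sub_nonneg.2 (pow_le_one₀ hε.le hε1)
  have hpt := fun ω : (ℕ → E) × (ℕ → EuclideanSpace ℝ (Fin p)) =>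
    tvDist_optimalFilter_le (μ := μ) (κ' := κ') hσ hh hH hε hε1 hmix hf hftest ω.2 n
  refine (lintegral_mono hpt).trans ?_
  have hm : ∀ k, Measurable fun ω : (ℕ → E) × (ℕ → EuclideanSpace ℝ (Fin p)) =>
      ENNReal.ofReal (2 / ε ^ 2 * (1 - ε ^ 2) ^ (n - 1 - k)) *
        (ENNReal.ofReal (likelihoodRatioBound σ H (ω.2 (k + 1))) *
          ⨆ i, ENNReal.ofReal (∫ x, f i x ∂(κ' ∘ₘ optimalFilter h σ μ κ' k ω.2) -
            ∫ x, f i x ∂(κ ∘ₘ optimalFilter h σ μ κ' k ω.2))) := fun k =>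
    ((measurable_likelihoodRatioBound_eval H (k + 1)).mul
      (measurable_predictionError hh f k)).const_mul _
  rw [lintegral_const_mul' _ _ ENNReal.ofNat_ne_top, lintegral_finsetSum _ fun k _ => hm k]
  refine mul_le_mul' le_rfl ?_
  calc _ ≤ ∑ k ∈ Finset.range n, ENNReal.ofReal (2 / ε ^ 2 * (1 - ε ^ 2) ^ (n - 1 - k)) * B := by
        refine Finset.sum_le_sum fun k _ => ?_
        rw [lintegral_const_mul' _ _ ENNReal.ofReal_ne_top]
        exact mul_le_mul' le_rfl (hB k)
    _ ≤ _ := by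
        rw [← Finset.sum_mul, ← ENNReal.ofReal_sum_of_nonneg fun k _ =>
          mul_nonneg (by positivity) (pow_nonneg hr _), ← Finset.mul_sum]
        gcongr
        exact sum_range_pow_sub_le hε hε1 n

end FilterError

end HMMFilter

/-! ### Uniform continuity of the filter in the parameter -/

theorem lemmaa
    {E : Type*} [TopologicalSpace E] [PolishSpace E] [MeasurableSpace E] [BorelSpace E]
    {Θ : Type*} [NormedAddCommGroup Θ] [NormedSpace ℝ Θ] [CompleteSpace Θ]
    (K : Θ → Kernel E E) [∀ θ, IsMarkovKernel (K θ)]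
    {p : ℕ} (h : E →ᵇ EuclideanSpace ℝ (Fin p)) {σ : ℝ} (hσ : 0 < σ)
    (μ μ' : Measure E) [IsProbabilityMeasure μ] [IsProbabilityMeasure μ']
    (α : Θ) (hmix : IsMixing (K α))
    -- the limiting distribution of the observations has finite first two moments
    (ρ : Measure E) (hρ : IsLimitingDistribution (K α) ρ)
    (hmom₁ : Integrable (fun y => y) (observationLimit h σ ρ))
    (hmom₂ : Integrable (fun y => ‖y‖ ^ 2) (observationLimit h σ ρ))
    -- near `α` the kernels have Fréchet derivatives `L θ`, with densities `ℓ θ` such that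
    -- `Λ_θ = supDensity (ℓ θ)` is well defined
    (N : Set Θ) (hN : N ∈ 𝓝 α)
    (L : Θ → (E →ᵇ ℝ) → (E →ᵇ StrongDual ℝ Θ)) (hL : ∀ θ ∈ N, IsWeakFDerivAt K (L θ) θ)
    (ℓ : Θ → E → E → StrongDual ℝ Θ) (hℓ : ∀ θ ∈ N, IsDensity (L θ) (K θ) (ℓ θ))
    (hΛ : ∀ θ ∈ N, UniversallyMeasurable (supDensity (ℓ θ)))
    -- the moment bound
    (hbound : (⨆ (n : ℕ) (_ : 0 < n) (θ ∈ N) (θ' ∈ N),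
      (∫⁻ x, ∫⁻ z, supDensity (ℓ θ') z ^ (n + 1) ∂K θ' (x (n - 1)) ∂chainLaw μ (K θ))
        ^ (1 / ((n : ℝ) + 1))) < ∞) :
    Tendsto (fun θ => ⨆ (n : ℕ) (_ : 0 < n),
        ∫⁻ ω, tvDist (optimalFilter h σ μ (K θ) n ω.2) (optimalFilter h σ μ (K α) n ω.2)
          ∂pairLaw h hσ μ' (K α))
      (𝓝 α) (𝓝 0) := by
  obtain ⟨ε, hε, hε1, lam, hlam, hmix⟩ := hmix
  have hh : Measurable h := h.continuous.measurable
  have hH : ∀ x, ‖h x‖ ≤ ‖h‖ := h.norm_coe_le_norm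
  set C₀ := ⨆ (n : ℕ) (_ : 0 < n) (θ ∈ N) (θ' ∈ N),
    (∫⁻ x, ∫⁻ z, supDensity (ℓ θ') z ^ (n + 1) ∂K θ' (x (n - 1)) ∂chainLaw μ (K θ))
      ^ (1 / ((n : ℝ) + 1))
  have hC₀ : ∀ n, ∀ θ ∈ N, ∀ θ' ∈ N,
      ∫⁻ x, ∫⁻ z, supDensity (ℓ θ') z ^ (n + 2) ∂K θ' (x n) ∂chainLaw μ (K θ) ≤ C₀ ^ (n + 2) := by
    intro n θ hθ θ' hθ'
    -- The moment bound is used at time `n + 1`, which gives the signal at time `n` and the exponent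
    -- `n + 2`.
    have h1 : (∫⁻ x, ∫⁻ z, supDensity (ℓ θ') z ^ (n + 1 + 1) ∂K θ' (x (n + 1 - 1))
        ∂chainLaw μ (K θ)) ^ (1 / (((n + 1 : ℕ) : ℝ) + 1)) ≤ C₀ :=
      le_iSup₂_of_le (n + 1) n.succ_pos (le_iSup₂_of_le θ hθ (le_iSup₂_of_le θ' hθ' le_rfl))
    rw [one_div, ENNReal.rpow_inv_le_iff (by positivity)] at h1
    have e : (((n + 1 : ℕ) : ℝ) + 1) = ((n + 2 : ℕ) : ℝ) := by push_cast; ring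
    rwa [e, ENNReal.rpow_natCast] at h1
  set C₁ := ∫⁻ v, ENNReal.ofReal (Real.exp (2 * ‖h‖ * (‖v‖ + 2 * ‖h‖) / σ ^ 2)) ∂gaussNoise p σ
  have hC₁ : C₁ ≠ ∞ := (lintegral_likelihoodRatioBound_lt_top hσ _).ne
  set C := ((C₁ * C₀ + 1) * C₁ + C₀).toReal
  have hCt : (C₁ * C₀ + 1) * C₁ + C₀ ≠ ∞ := by
    have := hbound.ne
    finiteness
  obtain ⟨f, hf0, hf, hftest⟩ := exists_seq_test_functions (E := E)
  -- A ball is convex, so the segment from `α` to `θ` stays inside `N`.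
  obtain ⟨r, hr, hrN⟩ := Metric.mem_nhds_iff.1 hN
  have hlocal : ∀ θ ∈ Metric.ball α r, ∀ n,
      ∫⁻ ω, ENNReal.ofReal (likelihoodRatioBound σ ‖h‖ (ω.2 (n + 1))) *
        ⨆ i, ENNReal.ofReal (∫ x, f i x ∂(K θ ∘ₘ optimalFilter h σ μ (K θ) n ω.2) -
            ∫ x, f i x ∂(K α ∘ₘ optimalFilter h σ μ (K θ) n ω.2)) ∂pairLaw h hσ μ' (K α) ≤
      ENNReal.ofReal (C * ‖θ - α‖) := by
    intro θ hθ n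
    have hseg : ∀ η ∈ segment ℝ α θ, η ∈ N := fun η hη =>
      hrN ((convex_ball α r).segment_subset (Metric.mem_ball_self hr) hθ hη)
    have := isMarkovKernel_filterKernel hh hσ μ (K θ) n
    have hfin : IsFiniteMeasure (weightedPairLaw h ‖h‖ hσ μ' (K α) (n + 1)) :=
      ⟨(weightedPairLaw_univ_le hσ hH _).trans_lt hC₁.lt_top⟩
    have key := lintegral_iSup_integral_sub_le (α := α) (θ := θ)
      (P := weightedPairLaw h ‖h‖ hσ μ' (K α) (n + 1)) (κ := filterKernel hh σ μ (K θ) n)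
      (fun η hη => hL η (hseg η hη)) (fun η hη => hℓ η (hseg η hη))
      (fun η hη => hΛ η (hseg η hη)) (C := C) ENNReal.toReal_nonneg (fun η hη => ?_) hf0 hf
    -- The likelihood weight had been absorbed into the base measure `P`; here it is moved back into
    -- the integrand.
    · rw [weightedPairLaw, lintegral_withDensity_eq_lintegral_mul_non_measurable _
        (measurable_likelihoodRatioBound_eval ‖h‖ (n + 1))
        (ae_of_all _ fun ω => ENNReal.ofReal_lt_top)] at key
      exact key
    · rw [ENNReal.ofReal_toReal hCt]
      exact lintegral_comp_filterKernel_le hh hσ hH n (hΛ η (hseg η hη)) hbound.ne hC₁ le_rfl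
        (hC₀ n θ (hrN hθ) η (hseg η hη))
  have hle : ∀ θ ∈ Metric.ball α r, (⨆ (n : ℕ) (_ : 0 < n),
      ∫⁻ ω, tvDist (optimalFilter h σ μ (K θ) n ω.2) (optimalFilter h σ μ (K α) n ω.2)
        ∂pairLaw h hσ μ' (K α)) ≤
      2 * (ENNReal.ofReal (2 / ε ^ 2 * (1 / ε ^ 2)) * ENNReal.ofReal (C * ‖θ - α‖)) := by
    intro θ hθ
    refine iSup₂_le fun n _ => ?_
    exact lintegral_tvDist_optimalFilter_le hσ hh hH hε hε1 hmix hf hftest (hlocal θ hθ) n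
  have hlim : Tendsto (fun θ => 2 * (ENNReal.ofReal (2 / ε ^ 2 * (1 / ε ^ 2)) *
      ENNReal.ofReal (C * ‖θ - α‖))) (𝓝 α) (𝓝 0) := by
    have h1 : Tendsto (fun θ => ENNReal.ofReal (C * ‖θ - α‖)) (𝓝 α) (𝓝 0) := by
      have : Continuous fun θ => ENNReal.ofReal (C * ‖θ - α‖) :=
        ENNReal.continuous_ofReal.comp (by fun_prop)
      simpa using this.tendsto α
    have h2 := ENNReal.Tendsto.const_mul (a := 2) (ENNReal.Tendsto.const_mul
      (a := ENNReal.ofReal (2 / ε ^ 2 * (1 / ε ^ 2))) h1 (Or.inr ENNReal.ofReal_ne_top))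
      (Or.inr ENNReal.ofNat_ne_top)
    simpa using h2
  exact tendsto_of_tendsto_of_tendsto_of_le_of_le' tendsto_const_nhds hlim
    (Eventually.of_forall fun _ => zero_le)
    (eventually_of_mem (Metric.ball_mem_nhds α hr) hle)
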